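/- Let $X$ be a computable metric space (a complete metric space with a dense sequence $(s_i)$ of ideal points whose mutual distances are computable reals, uniformly in the indices) which is recursively compact: $X$ is compact and one can semi-decide whether a given finite list of ideal balls $B(s_i,q)$, $q\in\mathbb{Q}_{>0}$, covers $X$. Let $D\subseteq X$ be a set with Hausdorff dimension $\dim_H(D)<\infty$, and let $T:X\to X$ be a Borel measurable map that is computable on $X\setminus D$: there are sets $U_n$, recursively open uniformly in $n$ (unions of r.e. families of ideal balls, uniformly), such that $T^{-1}(B_n)\cap (X\setminus D)=U_n\cap (X\setminus D)$ for every $n$, where $(B_n)$ is the standard enumeration of the ideal balls. For real numbers $\alpha>\dim_H(D)$ and $K$ put $$\|\mu\|_\alpha=\sup_{x\in X,\ r>0}\frac{\mu(B(x,r))}{r^\alpha},\qquad V_{\alpha,K}=\{\mu\in PM(X):\|\mu\|_\alpha\le K\},$$ where $PM(X)$ is the set of Borel probability measures on $X$. Then: 1. $\mu(D)=0$ for every $\mu\in V_{\alpha,K}$ (where $\mu$ of a non-measurable set is its outer measure); 2. if moreover $\alpha$ and $K$ are computable reals, then every $T$-invariant measure $\mu\in V_{\alpha,K}$ that is isolated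 in $V_{\alpha,K}$ (some neighbourhood of $\mu$ in the weak topology contains no other $T$-invariant measure of $V_{\alpha,K}$) is computable, i.e. there is a recursive sequence $(\mu_n)$ of finite rational convex combinations of Dirac masses at ideal points with $$W_1(\mu_n,\mu)<2^{-n}\quad\text{for all } n,\qquad W_1(\mu,\nu)=\sup_{f\ 1\text{-Lipschitz}}\Big|\int f\,d\mu-\int f\,d\nu\Big|.$$ -/

import Mathlib

open MeasureTheory Set Filter Topology

/-! ### Computable reals -/

/-- An effective numbering (with repetitions) of the rational numbers:
`⟨⟨a, b⟩, c⟩ ↦ (a - b) / (c + 1)`. -/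
def ratOfNat (n : ℕ) : ℚ :=
  ((n.unpair.1.unpair.1 : ℚ) - (n.unpair.1.unpair.2 : ℚ)) / ((n.unpair.2 : ℚ) + 1)

/-- An effective numbering (with repetitions) of the positive rational numbers:
`⟨a, b⟩ ↦ (a + 1) / (b + 1)`. -/
def posRatOfNat (n : ℕ) : ℚ :=
  ((n.unpair.1 : ℚ) + 1) / ((n.unpair.2 : ℚ) + 1)

/-- The reals `x i` are lower semi-computable uniformly in `i`: the set of all pairs
`(i, q)` with `q` rational and `q < x i` is recursively enumerable. -/
def UnifLowerSemicomputable {ι : Type} [Primcodable ι] (x : ι → ℝ) : Prop :=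
  REPred fun p : ι × ℕ => (ratOfNat p.2 : ℝ) < x p.1

/-- The reals `x i` are upper semi-computable uniformly in `i`. -/
def UnifUpperSemicomputable {ι : Type} [Primcodable ι] (x : ι → ℝ) : Prop :=
  REPred fun p : ι × ℕ => x p.1 < (ratOfNat p.2 : ℝ)

/-- The reals `x i` are computable uniformly in `i`. -/
def UnifComputableReal {ι : Type} [Primcodable ι] (x : ι → ℝ) : Prop :=
  UnifLowerSemicomputable x ∧ UnifUpperSemicomputable x

/-- A computable real number: the sets of rationals below it and of rationals above it are
both recursively enumerable. -/
def IsComputableReal (x : ℝ) : Prop :=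
  (REPred fun n : ℕ => (ratOfNat n : ℝ) < x) ∧ (REPred fun n : ℕ => x < (ratOfNat n : ℝ))

/-! ### Computable metric spaces -/

/-- A computable metric space: a complete metric space `X` with a dense sequence of ideal points
whose mutual distances are computable reals, uniformly. -/
structure ComputableMetricStructure (X : Type*) [MetricSpace X] where
  /-- the numbered set of ideal points -/
  pt : ℕ → X
  complete : CompleteSpace X
  dense : DenseRange pt
  computable_dist : UnifComputableReal fun p : ℕ × ℕ => dist (pt p.1) (pt p.2)

namespace ComputableMetricStructure

variable {X : Type*} [MetricSpace X] (S : ComputableMetricStructure X)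

/-- The numbering of ideal balls: `⟨i, j⟩ ↦ B(s_i, q_j)` with `q_j` the `j`-th positive rational. -/
def idealBall (n : ℕ) : Set X :=
  Metric.ball (S.pt n.unpair.1) (posRatOfNat n.unpair.2 : ℝ)

/-- The sets `U n` are recursively open, uniformly in `n`: each `U n` is the union of the ideal
balls whose numbers lie in the `n`-th section of one recursively enumerable set. -/
def UnifRecursivelyOpen (U : ℕ → Set X) : Prop :=
  ∃ E : ℕ × ℕ → Prop, REPred E ∧ ∀ n, U n = ⋃ (i : ℕ) (_ : E (n, i)), S.idealBall i

/-- `T : X → X` is computable on `C`: there are uniformly recursively open sets `U n` with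
`T⁻¹(B_n) ∩ C = U_n ∩ C` for every ideal ball `B_n`. -/
def ComputableOn (T : X → X) (C : Set X) : Prop :=
  ∃ U : ℕ → Set X, S.UnifRecursivelyOpen U ∧ ∀ n, T ⁻¹' (S.idealBall n) ∩ C = U n ∩ C

/-- `A` is recursively compact: it is compact, and the finite lists of ideal balls that
cover `A` are semi-decidable. -/
def RecursivelyCompact (A : Set X) : Prop :=
  IsCompact A ∧ REPred fun l : List ℕ => A ⊆ ⋃ i ∈ l, S.idealBall i

/-! ### Computable probability measures -/

variable [MeasurableSpace X]

/-- The finite measure `∑ (w + 1) δ_{s_i}`, summed over the pairs `(i, w)` of the list. -/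
noncomputable def diracSum (l : List (ℕ × ℕ)) : Measure X :=
  (l.map fun p => ((p.2 : ENNReal) + 1) • Measure.dirac (S.pt p.1)).sum

/-- The total mass of `diracSum`. -/
def diracSumWeight (l : List (ℕ × ℕ)) : ℕ :=
  (l.map fun p => p.2 + 1).sum

theorem diracSum_univ (l : List (ℕ × ℕ)) :
    S.diracSum l univ = (diracSumWeight l : ENNReal) := by
  induction l with
  | nil => simp [diracSum, diracSumWeight]
  | cons p l ih =>
    have h1 : S.diracSum (p :: l)
        = ((p.2 : ENNReal) + 1) • Measure.dirac (S.pt p.1) + S.diracSum l := by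
      simp [diracSum]
    have h2 : diracSumWeight (p :: l) = p.2 + 1 + diracSumWeight l := by
      simp [diracSumWeight]
    rw [h1, h2, Measure.add_apply, ih]
    simp

/-- The numbered set of ideal measures: the finite rational convex combinations of Dirac masses at
ideal points. The name `((i₀, w₀), [(i₁, w₁), …])` denotes the convex combination of the `δ_{s_{i_k}}`
with weights `(w_k + 1) / ∑ (w_j + 1)`. -/
noncomputable def idealMeasure (c : (ℕ × ℕ) × List (ℕ × ℕ)) : ProbabilityMeasure X :=
  ⟨((diracSumWeight (c.1 :: c.2) : ENNReal))⁻¹ • S.diracSum (c.1 :: c.2), ⟨by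
    rw [Measure.smul_apply, diracSum_univ, smul_eq_mul]
    refine ENNReal.inv_mul_cancel ?_ (ENNReal.natCast_ne_top _)
    simp [diracSumWeight]⟩⟩

end ComputableMetricStructure

/-- The Wasserstein–Kantorovich distance `sup |∫ f dμ - ∫ f dν|` over the 1-Lipschitz functions `f`.
(On a bounded space, which is where it is used, the supremum is over a bounded set and the
functions are integrable.) -/
noncomputable def wasserstein {X : Type*} [MetricSpace X] [MeasurableSpace X]
    (μ ν : ProbabilityMeasure X) : ℝ :=
  ⨆ f : {f : X → ℝ // LipschitzWith 1 f},
    |(∫ x, f.1 x ∂(μ : Measure X)) - ∫ x, f.1 x ∂(ν : Measure X)|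

/-- `μ` is computable: some recursive sequence of ideal measures converges to `μ` at the rate
`2⁻ⁿ` in the Wasserstein–Kantorovich distance. -/
def ComputableMetricStructure.IsComputableMeasure {X : Type*} [MetricSpace X] [MeasurableSpace X]
    (S : ComputableMetricStructure X) (μ : ProbabilityMeasure X) : Prop :=
  ∃ φ : ℕ → (ℕ × ℕ) × List (ℕ × ℕ), Computable φ ∧
    ∀ n, wasserstein (S.idealMeasure (φ n)) μ < (1 / 2 : ℝ) ^ n

/-! ### Regular and isolated invariant measures -/

/-- `‖μ‖_α = sup_{x, r > 0} μ(B(x, r)) / r ^ α`, with values in `[0, ∞]`. -/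
noncomputable def regNorm {X : Type*} [MetricSpace X] [MeasurableSpace X]
    (α : ℝ) (μ : ProbabilityMeasure X) : ENNReal :=
  ⨆ (x : X) (r : ℝ) (_ : 0 < r), (μ : Measure X) (Metric.ball x r) / ENNReal.ofReal (r ^ α)

/-- `V_{α,K}`: the Borel probability measures with `‖μ‖_α ≤ K`. -/
def regMeasures (X : Type*) [MetricSpace X] [MeasurableSpace X] (α K : ℝ) :
    Set (ProbabilityMeasure X) :=
  {μ | (regNorm α μ : EReal) ≤ (K : EReal)}

/-- `μ` is a `T`-invariant measure isolated in `V`: it is a `T`-invariant element of `V`, and some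
neighbourhood of it (for the weak topology) contains no other `T`-invariant element of `V`. -/
def IsIsolatedInvariant {X : Type*} [MetricSpace X] [MeasurableSpace X] [BorelSpace X]
    (T : X → X) (V : Set (ProbabilityMeasure X)) (μ : ProbabilityMeasure X) : Prop :=
  μ ∈ V ∧ MeasurePreserving T (μ : Measure X) (μ : Measure X) ∧
    ∃ O : Set (ProbabilityMeasure X), IsOpen O ∧ μ ∈ O ∧
      ∀ ν ∈ O, ν ∈ V → MeasurePreserving T (ν : Measure X) (ν : Measure X) → ν = μ

/-! Null sets: a measure with `ν(B(x,r)) ≤ K r^α` gives every set `s` mass at most `K (diam s)^α`.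
Hence it is at most a constant times the `α`-dimensional Hausdorff measure, which vanishes on `D`
because `α > dim_H D` (`measure_eq_zero_of_dimH_lt`).

Computability: call "test" an inequality `∫ P dν ≤ ∫ Q dν` between sums of bump functions built from
distances to ideal points. Membership in `V_{α,K}` is an r.e. system of tests. So is invariance for
measures in `V_{α,K}`: `D` is null for them, so `T⁻¹(B_n)` may be replaced by the open set `U_n`. A
neighbourhood isolating `μ` can be shrunk to one cut out by finitely many tests
(`exists_list_tests_subset`), and finitely many constants can be built into an algorithm. So `μ` is
the unique solution of an r.e. system of tests.

Uniqueness makes strict inequalities at `μ` semi-decidable (`rePred_integral_lt`). Indeed `∫ P dμ <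
∫ Q dμ` holds iff the system together with the reversed test `∫ Q ≤ ∫ P` has no solution. By
Hahn–Banach and Riesz (`exists_list_sum_pos_of_forall_integral_pos`), unsolvability has a finite
certificate: finitely many tests whose left sides sum to strictly more than their right sides at
every point. Recursive compactness lets such certificates be recognised (`rePred_bumpSum_lt`), so no
effective compactness of the space of measures is needed.

Finally, for each precision, search for an ideal measure whose weights satisfy finitely many strict
integral inequalities (`MassBound`) which force it to be close to `μ` in `W_1`; one always exists
(`exists_massBound`). -/

/-! ### Closure properties of recursively enumerable predicates. -/

namespace REPred

variable {α β : Type*} [Primcodable α] [Primcodable β]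

/-- An r.e. predicate is the projection of an increasing sequence of primitive recursive stages. -/
theorem exists_stage {p : α → Prop} (hp : REPred p) :
    ∃ R : ℕ → α → Bool, Primrec₂ R ∧ (∀ a, p a ↔ ∃ k, R k a = true) ∧
      ∀ a k k', k ≤ k' → R k a = true → R k' a = true := by
  obtain ⟨c, hc⟩ := Nat.Partrec.Code.exists_code.1 hp
  -- Stage `k` runs a program for `p` with fuel `k`; more fuel never loses a result.
  refine ⟨fun k a => (Nat.Partrec.Code.evaln k c (Encodable.encode a)).isSome, ?_, ?_, ?_⟩
  · exact Primrec.option_isSome.comp (Nat.Partrec.Code.primrec_evaln.comp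
      ((Primrec.fst.pair (Primrec.const c)).pair (Primrec.encode.comp Primrec.snd)))
  · intro a
    have h1 : p a ↔ (Nat.Partrec.Code.eval c (Encodable.encode a)).Dom := by
      rw [hc]; simp [Part.assert]
    rw [h1, Part.dom_iff_mem]
    simp only [Nat.Partrec.Code.evaln_complete, Option.isSome_iff_exists]
    exact ⟨fun ⟨x, k, h⟩ => ⟨k, x, h⟩, fun ⟨k, x, h⟩ => ⟨x, k, h⟩⟩
  · intro a k k' hk h
    obtain ⟨x, hx⟩ := Option.isSome_iff_exists.1 h
    exact Option.isSome_iff_exists.2 ⟨x, Nat.Partrec.Code.evaln_mono hk hx⟩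

theorem of_exists_stage {R : α → ℕ → Bool} (hR : Computable₂ R) :
    REPred fun a => ∃ k, R a k = true := by
  refine (Partrec.rfind hR.partrec₂).dom_re.of_eq fun a => ?_
  rw [Nat.rfind_dom]
  constructor
  · rintro ⟨n, h, -⟩
    exact ⟨n, by simpa using h⟩
  · rintro ⟨n, h⟩
    exact ⟨n, by simpa using h, fun _ => trivial⟩

theorem comp {p : β → Prop} (hp : REPred p) {f : α → β} (hf : Computable f) :
    REPred fun a => p (f a) :=
  Partrec.comp hp hf

theorem of_bool {f : α → Bool} (hf : Computable f) : REPred fun a => f a = true :=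
  (of_exists_stage (R := fun a _ => f a) (hf.comp Computable.fst)).of_eq fun a => by simp

protected theorem and {p q : α → Prop} (hp : REPred p) (hq : REPred q) :
    REPred fun a => p a ∧ q a := by
  obtain ⟨R, hR, h1, h2⟩ := hp.exists_stage
  obtain ⟨R', hR', h1', h2'⟩ := hq.exists_stage
  refine (of_exists_stage (R := fun a k => R k a && R' k a)
    (Primrec.and.comp (hR.comp Primrec.snd Primrec.fst)
      (hR'.comp Primrec.snd Primrec.fst)).to_comp).of_eq fun a => ?_
  simp only [h1, h1', Bool.and_eq_true]
  constructor
  · rintro ⟨k, h, h'⟩; exact ⟨⟨k, h⟩, k, h'⟩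
  · rintro ⟨⟨k, h⟩, k', h'⟩
    exact ⟨max k k', h2 _ _ _ (le_max_left _ _) h, h2' _ _ _ (le_max_right _ _) h'⟩

protected theorem or {p q : α → Prop} (hp : REPred p) (hq : REPred q) :
    REPred fun a => p a ∨ q a := by
  obtain ⟨R, hR, h1, -⟩ := hp.exists_stage
  obtain ⟨R', hR', h1', -⟩ := hq.exists_stage
  refine (of_exists_stage (R := fun a k => R k a || R' k a)
    (Primrec.or.comp (hR.comp Primrec.snd Primrec.fst)
      (hR'.comp Primrec.snd Primrec.fst)).to_comp).of_eq fun a => ?_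
  simp only [h1, h1', Bool.or_eq_true, exists_or]

/-- Projection of an r.e. predicate along a coded type. -/
theorem exists_snd {p : α × β → Prop} (hp : REPred p) : REPred fun a => ∃ b, p (a, b) := by
  obtain ⟨R, hR, h1, -⟩ := hp.exists_stage
  -- Dovetailing: `k` codes a candidate witness together with a stage; codes of no witness are
  -- rejected by the default `false`.
  have hP : Primrec₂ fun (a : α) (k : ℕ) =>
      ((Encodable.decode (α := β) k.unpair.1).map fun b => R k.unpair.2 (a, b)).getD false := by
    refine Primrec.option_getD.comp (Primrec.option_map (Primrec.decode.comp
      (Primrec.fst.comp (Primrec.unpair.comp Primrec.snd))) ?_) (Primrec.const false)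
    exact hR.comp (Primrec.snd.comp (Primrec.unpair.comp (Primrec.snd.comp Primrec.fst)))
      ((Primrec.fst.comp Primrec.fst).pair Primrec.snd)
  refine (of_exists_stage hP.to_comp).of_eq fun a => ?_
  constructor
  · rintro ⟨k, h⟩
    cases hd : Encodable.decode (α := β) k.unpair.1 with
    | none => simp [hd] at h
    | some b => exact ⟨b, (h1 _).2 ⟨k.unpair.2, by simpa [hd] using h⟩⟩
  · rintro ⟨b, h⟩
    obtain ⟨k, hk⟩ := (h1 _).1 h
    exact ⟨Nat.pair (Encodable.encode b) k, by simp [hk]⟩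

/-- Bounded quantification over a list. -/
theorem forall_mem {p : β × α → Prop} (hp : REPred p) {l : α → List β} (hl : Computable l) :
    REPred fun a => ∀ b ∈ l a, p (b, a) := by
  obtain ⟨R, hR, h1, h2⟩ := hp.exists_stage
  have hP : PrimrecRel fun (b : β) (c : ℕ × α) => R c.1 (b, c.2) = true :=
    (PrimrecPred.of_eq (p := fun x : β × (ℕ × α) => R x.2.1 (x.1, x.2.2) = true)
      ⟨inferInstance, (hR.comp (Primrec.fst.comp Primrec.snd)
      (Primrec.fst.pair (Primrec.snd.comp Primrec.snd))).of_eq fun x => by simp⟩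
      fun _ => Iff.rfl)
  obtain ⟨hdec, hall⟩ := PrimrecRel.forall_mem_list hP
  have hC : Computable₂ fun (a : α) (k : ℕ) =>
      @decide (∀ b ∈ l a, R k (b, a) = true) (hdec (l a, (k, a))) :=
    hall.to_comp.comp ((hl.comp Computable.fst).pair (Computable.snd.pair Computable.fst))
  refine (of_exists_stage hC).of_eq fun a => ?_
  simp only [decide_eq_true_eq]
  constructor
  · rintro ⟨k, h⟩ b hb
    exact (h1 _).2 ⟨k, h b hb⟩
  · intro h
    have h' : ∀ b ∈ l a, ∃ k, R k (b, a) = true := fun b hb => (h1 _).1 (h b hb)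
    generalize l a = L at h'
    induction L with
    | nil => exact ⟨0, by simp⟩
    | cons b L ih =>
      obtain ⟨k, hk⟩ := ih fun b hb => h' b (List.mem_cons_of_mem _ hb)
      obtain ⟨k', hk'⟩ := h' b List.mem_cons_self
      -- Stages increase, so finitely many elements share a common stage.
      refine ⟨max k k', fun c hc => ?_⟩
      rcases List.mem_cons.1 hc with rfl | hc
      · exact h2 _ _ _ (le_max_right _ _) hk'
      · exact h2 _ _ _ (le_max_left _ _) (hk c hc)

/-- Effective choice: a total r.e. relation has a computable uniformization. -/
theorem exists_computable {p : α × β → Prop} (hp : REPred p) (h : ∀ a, ∃ b, p (a, b)) :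
    ∃ f : α → β, Computable f ∧ ∀ a, p (a, f a) := by
  obtain ⟨R, hR, h1, -⟩ := hp.exists_stage
  let F : α → ℕ → Option β := fun a k => (Encodable.decode (α := β) k.unpair.1).bind fun b =>
    bif R k.unpair.2 (a, b) then some b else none
  have hF : Primrec₂ F := by
    refine Primrec.option_bind (Primrec.decode.comp
      (Primrec.fst.comp (Primrec.unpair.comp Primrec.snd))) ?_
    exact Primrec.cond (hR.comp (Primrec.snd.comp (Primrec.unpair.comp
      (Primrec.snd.comp Primrec.fst))) ((Primrec.fst.comp Primrec.fst).pair Primrec.snd))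
      (Primrec.option_some.comp Primrec.snd) (Primrec.const none)
  have hspec : ∀ a k b, b ∈ F a k → p (a, b) := by
    intro a k b hb
    obtain ⟨c, -, hc⟩ := Option.bind_eq_some_iff.1 hb
    cases hr : R k.unpair.2 (a, c) with
    | false => simp [hr] at hc
    | true =>
      obtain rfl : c = b := by simpa [hr] using hc
      exact (h1 _).2 ⟨_, hr⟩
  have hdom : ∀ a, (Nat.rfindOpt (F a)).Dom := by
    intro a
    obtain ⟨b, hb⟩ := h a
    obtain ⟨k, hk⟩ := (h1 _).1 hb
    exact Nat.rfindOpt_dom.2 ⟨Nat.pair (Encodable.encode b) k, b, by simp [F, hk]⟩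
  refine ⟨fun a => (Nat.rfindOpt (F a)).get (hdom a),
    (Partrec.rfindOpt hF.to_comp).of_eq_tot fun a => Part.get_mem _, fun a => ?_⟩
  obtain ⟨k, hk⟩ := Nat.rfindOpt_spec (Part.get_mem (hdom a))
  exact hspec a k _ hk

end REPred

/-! ### Computable list operations and elementary inequalities. -/

namespace Computable

variable {α β : Type*} [Primcodable α] [Primcodable β]

/-- Since `g` is only computable, not primitive recursive, the sum is built by recursion on the
index, with the sums over `L.take n` as partial results. -/
theorem list_map_sum {l : α → List β} {g : α → β → ℕ} (hl : Computable l) (hg : Computable₂ g) :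
    Computable fun a => ((l a).map (g a)).sum := by
  have hstep : Computable₂ fun (a : α) (y : ℕ × ℕ) =>
      y.2 + (((l a)[y.1]?).map (g a)).getD 0 := by
    refine Primrec.nat_add.to_comp.comp (Computable.snd.comp Computable.snd)
      (Computable.option_getD (Computable.option_map (Computable.list_getElem?.comp
        (hl.comp Computable.fst) (Computable.fst.comp Computable.snd)) ?_) (Computable.const 0))
    exact hg.comp (Computable.fst.comp Computable.fst) Computable.snd
  refine (Computable.nat_rec (Computable.list_length.comp hl) (Computable.const 0) hstep).of_eq
    fun a => ?_
  have : ∀ (L : List β) (n : ℕ),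
      (Nat.rec 0 (fun n s => s + ((L[n]?).map (g a)).getD 0) n : ℕ) = ((L.take n).map (g a)).sum := by
    intro L n
    induction n with
    | zero => simp
    | succ n ih =>
      rw [List.take_add_one, List.map_append, List.sum_append, ← ih]
      rcases h : L[n]? with _ | v <;> simp [h]
  simpa using this (l a) (l a).length

theorem nat_pow : Computable₂ fun a b : ℕ => a ^ b := by
  refine (Computable.nat_rec (f := fun p : ℕ × ℕ => p.2) (g := fun _ => 1)
    (h := fun p y => y.2 * p.1) Computable.snd (Computable.const 1) ?_).of_eq fun p => ?_
  · exact Primrec.nat_mul.to_comp.comp (Computable.snd.comp Computable.snd)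
      (Computable.fst.comp Computable.fst)
  · induction p.2 with
    | zero => simp
    | succ n ih => simp [pow_succ, ih]

theorem list_replicate : Computable₂ fun (n : ℕ) (a : α) => List.replicate n a := by
  refine (Primrec.list_map (Primrec.list_range.comp Primrec.fst)
    (g := fun (p : ℕ × α) (_ : ℕ) => p.2) (Primrec.snd.comp Primrec.fst)).to_comp.of_eq
    fun p => ?_
  simp [List.map_const']

end Computable

theorem List.abs_sum_map_sub_sum_map_le {β : Type*} (l : List β) {f g e : β → ℝ}
    (h : ∀ x ∈ l, |f x - g x| ≤ e x) : |(l.map f).sum - (l.map g).sum| ≤ (l.map e).sum := by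
  induction l with
  | nil => simp
  | cons a l ih =>
    have h1 := h a List.mem_cons_self
    have h2 := ih fun x hx => h x (List.mem_cons_of_mem _ hx)
    simp only [List.map_cons, List.sum_cons]
    rw [abs_le] at *
    constructor <;> linarith [h1.1, h1.2, h2.1, h2.2]

theorem abs_min_one_sub_min_one_le (a b : ℝ) : |min 1 a - min 1 b| ≤ |a - b| := by
  simpa using abs_min_sub_min_le_max 1 a 1 b

theorem abs_max_zero_sub_max_zero_le (a b : ℝ) : |max 0 a - max 0 b| ≤ |a - b| := by
  simpa using abs_max_sub_max_le_max 0 a 0 b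

theorem Nat.cast_sub_eq_max (m n : ℕ) : ((m - n : ℕ) : ℝ) = max 0 ((m : ℝ) - n) := by
  rcases le_total n m with h | h
  · rw [Nat.cast_sub h, max_eq_right]
    simpa using h
  · rw [Nat.sub_eq_zero_of_le h, max_eq_left] <;> simp [h]

/-! ### Bump functions and the effective comparison of their sums. -/

/-- The radius of the ideal ball with number `n`. -/
noncomputable def ballRadius (n : ℕ) : ℝ := posRatOfNat n.unpair.2

theorem ballRadius_eq (n : ℕ) :
    ballRadius n = ((n.unpair.2.unpair.1 : ℝ) + 1) / ((n.unpair.2.unpair.2 : ℝ) + 1) := by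
  simp [ballRadius, posRatOfNat]

theorem ballRadius_pos (n : ℕ) : 0 < ballRadius n := by
  rw [ballRadius_eq]; positivity

/-- A Lipschitz bound for the bump function with the given name. -/
def bumpLip (u : List ℕ × ℕ) : ℕ := u.2 * u.1.length

/-- A Lipschitz bound for a sum of bump functions. -/
def bumpSumLip (P : List (List ℕ × ℕ)) : ℕ := (P.map bumpLip).sum

namespace ComputableMetricStructure

variable {X : Type*} [MetricSpace X] (S : ComputableMetricStructure X)

/-- The bump function `x ↦ min 1 (k * ∑ (r - d(x, s))⁺)`, the sum ranging over a list of ideal balls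
`B(s, r)`. -/
noncomputable def bump (u : List ℕ × ℕ) (x : X) : ℝ :=
  min 1 (u.2 * (u.1.map fun n => max 0 (ballRadius n - dist (S.pt n.unpair.1) x)).sum)

/-- A finite sum of bump functions. -/
noncomputable def bumpSum (P : List (List ℕ × ℕ)) (x : X) : ℝ :=
  (P.map fun u => S.bump u x).sum

theorem mem_idealBall {n : ℕ} {x : X} :
    x ∈ S.idealBall n ↔ dist (S.pt n.unpair.1) x < ballRadius n := by
  rw [idealBall, Metric.mem_ball', ballRadius]

theorem bump_lipschitz (u : List ℕ × ℕ) (x y : X) :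
    |S.bump u x - S.bump u y| ≤ bumpLip u * dist x y := by
  refine (abs_min_one_sub_min_one_le _ _).trans ?_
  rw [← mul_sub, abs_mul, Nat.abs_cast, bumpLip, Nat.cast_mul, mul_assoc]
  gcongr
  refine (List.abs_sum_map_sub_sum_map_le _ (e := fun _ => dist x y) fun n _ => ?_).trans ?_
  · refine (abs_max_zero_sub_max_zero_le _ _).trans ?_
    rw [sub_sub_sub_cancel_left, abs_sub_comm]
    rw [dist_comm _ x, dist_comm _ y]
    exact abs_dist_sub_le x y _
  · simp

theorem bumpSum_lipschitz (P : List (List ℕ × ℕ)) (x y : X) :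
    |S.bumpSum P x - S.bumpSum P y| ≤ bumpSumLip P * dist x y := by
  refine (List.abs_sum_map_sub_sum_map_le _ fun u _ => S.bump_lipschitz u x y).trans ?_
  rw [List.sum_map_mul_right, bumpSumLip, Nat.cast_list_sum, List.map_map]
  rfl

/-- Integer approximations of the scaled distances of ideal points. -/
theorem exists_dist_approx : ∃ A : (ℕ × ℕ) × ℕ → ℕ, Computable A ∧
    ∀ i j N : ℕ, |(A ((i, j), N) : ℝ) - (N + 1) * dist (S.pt i) (S.pt j)| ≤ 1 := by
  -- For `c = 0` and `c = 1` the code denotes `(n - 1) / (N + 1)` and `(n + 1) / (N + 1)`: one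
  -- searches for an `n` such that the distance lies strictly between them.
  have hc : ∀ c : ℕ, Computable fun p : ((ℕ × ℕ) × ℕ) × ℕ =>
      (p.1.1, Nat.pair (Nat.pair (p.2 + c) (1 - c)) p.1.2) := fun c =>
    (Computable.fst.comp Computable.fst).pair (Primrec₂.natPair.to_comp.comp
      (Primrec₂.natPair.to_comp.comp (Primrec.nat_add.to_comp.comp Computable.snd
        (Computable.const c)) (Computable.const _)) (Computable.snd.comp Computable.fst))
  obtain ⟨A, hA, h⟩ := ((S.computable_dist.1.comp (hc 0)).and
    (S.computable_dist.2.comp (hc 1))).exists_computable fun p =>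
      ⟨⌊((p.2 : ℝ) + 1) * dist (S.pt p.1.1) (S.pt p.1.2)⌋₊, by
        have hN : (0 : ℝ) < (p.2 : ℝ) + 1 := by positivity
        have h1 := Nat.floor_le (a := ((p.2 : ℝ) + 1) * dist (S.pt p.1.1) (S.pt p.1.2))
          (by positivity)
        have h2 := Nat.lt_floor_add_one (((p.2 : ℝ) + 1) * dist (S.pt p.1.1) (S.pt p.1.2))
        simp only [ratOfNat, Nat.unpair_pair]
        push_cast
        constructor
        · rw [div_lt_iff₀ hN]; linarith
        · rw [lt_div_iff₀ hN]; linarith⟩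
  refine ⟨A, hA, fun i j N => ?_⟩
  have hN : (0 : ℝ) < (N : ℝ) + 1 := by positivity
  obtain ⟨h1, h2⟩ := h ((i, j), N)
  simp only [ratOfNat, Nat.unpair_pair] at h1 h2
  push_cast at h1 h2
  rw [div_lt_iff₀ hN] at h1
  rw [lt_div_iff₀ hN] at h2
  rw [abs_le]
  constructor <;> linarith

section Approx

variable (A : (ℕ × ℕ) × ℕ → ℕ)

/-- Integer part of the scaled radius of an ideal ball. -/
def scaledRadius (N n : ℕ) : ℕ := (N + 1) * (n.unpair.2.unpair.1 + 1) / (n.unpair.2.unpair.2 + 1)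

theorem scaledRadius_le (N n : ℕ) : (scaledRadius N n : ℝ) ≤ (N + 1) * ballRadius n := by
  rw [ballRadius_eq, scaledRadius, ← mul_div_assoc]
  exact_mod_cast Nat.cast_div_le (α := ℝ)

theorem lt_scaledRadius (N n : ℕ) : (N + 1) * ballRadius n < scaledRadius N n + 1 := by
  rw [ballRadius_eq, scaledRadius, ← mul_div_assoc, div_lt_iff₀ (by positivity)]
  exact_mod_cast Nat.lt_mul_of_div_lt (Nat.lt_succ_self _) (Nat.succ_pos _)

/-- Integer approximation of the scaled value of a bump function at an ideal point. -/
def bumpApprox (N i : ℕ) (u : List ℕ × ℕ) : ℕ :=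
  min (N + 1) (u.2 * (u.1.map fun n => scaledRadius N n - A ((n.unpair.1, i), N)).sum)

/-- Integer approximation of the scaled value of a sum of bump functions at an ideal point. -/
def bumpSumApprox (N i : ℕ) (P : List (List ℕ × ℕ)) : ℕ :=
  (P.map (bumpApprox A N i)).sum

variable {A}

/-- Each ball contributes an error of at most 2, one from `A` and one from rounding the radius down.
Truncated subtraction is the positive part, and both it and the cut-off at 1 are 1-Lipschitz. -/
theorem abs_bumpApprox_sub_le
    (hA : ∀ i j N : ℕ, |(A ((i, j), N) : ℝ) - (N + 1) * dist (S.pt i) (S.pt j)| ≤ 1)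
    (N i : ℕ) (u : List ℕ × ℕ) :
    |(bumpApprox A N i u : ℝ) - (N + 1) * S.bump u (S.pt i)| ≤ 2 * bumpLip u := by
  have hN : (0 : ℝ) ≤ (N : ℝ) + 1 := by positivity
  rw [bump, bumpApprox, Nat.cast_min, mul_min_of_nonneg _ _ hN, mul_one]
  push_cast
  refine (abs_min_sub_min_le_max _ _ _ _).trans ?_
  rw [sub_self, abs_zero, max_eq_right (abs_nonneg _), mul_left_comm, ← mul_sub, abs_mul,
    Nat.abs_cast, bumpLip, Nat.cast_mul, mul_left_comm]
  gcongr
  rw [List.map_map, ← List.sum_map_mul_left]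
  refine (List.abs_sum_map_sub_sum_map_le _ (e := fun _ => 2) fun n _ => ?_).trans
    (le_of_eq (by simp [mul_comm]))
  rw [mul_max_of_nonneg _ _ hN, mul_zero, Function.comp_apply, Nat.cast_sub_eq_max]
  refine (abs_max_zero_sub_max_zero_le _ _).trans ?_
  have h1 := abs_le.1 (hA n.unpair.1 i N)
  have h2 := scaledRadius_le N n
  have h3 := lt_scaledRadius N n
  rw [abs_le]
  constructor <;> linarith [h1.1, h1.2]

theorem abs_bumpSumApprox_sub_le
    (hA : ∀ i j N : ℕ, |(A ((i, j), N) : ℝ) - (N + 1) * dist (S.pt i) (S.pt j)| ≤ 1)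
    (N i : ℕ) (P : List (List ℕ × ℕ)) :
    |(bumpSumApprox A N i P : ℝ) - (N + 1) * S.bumpSum P (S.pt i)| ≤ 2 * bumpSumLip P := by
  rw [bumpSumApprox, bumpSum, bumpSumLip, Nat.cast_list_sum, Nat.cast_list_sum,
    List.map_map, List.map_map, ← List.sum_map_mul_left, ← List.sum_map_mul_left]
  exact List.abs_sum_map_sub_sum_map_le _ fun u _ => S.abs_bumpApprox_sub_le hA N i u

theorem computable_scaledRadius : Computable fun p : ℕ × ℕ => scaledRadius p.1 p.2 := by
  have h : Primrec fun p : ℕ × ℕ => p.2.unpair.2.unpair :=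
    Primrec.unpair.comp (Primrec.snd.comp (Primrec.unpair.comp Primrec.snd))
  have h1 : Primrec fun p : ℕ × ℕ => (p.1 + 1) * (p.2.unpair.2.unpair.1 + 1) :=
    Primrec.nat_mul.comp (Primrec.succ.comp Primrec.fst) (Primrec.succ.comp (Primrec.fst.comp h))
  have h2 : Primrec fun p : ℕ × ℕ => p.2.unpair.2.unpair.2 + 1 :=
    Primrec.succ.comp (Primrec.snd.comp h)
  exact (Primrec.nat_div.comp h1 h2).to_comp

theorem computable_bumpApprox (hA : Computable A) :
    Computable fun p : (ℕ × ℕ) × (List ℕ × ℕ) => bumpApprox A p.1.1 p.1.2 p.2 := by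
  have hN : Computable fun p : ((ℕ × ℕ) × (List ℕ × ℕ)) × ℕ => p.1.1.1 :=
    Computable.fst.comp (Computable.fst.comp Computable.fst)
  have hi : Computable fun p : ((ℕ × ℕ) × (List ℕ × ℕ)) × ℕ => (p.2.unpair.1, p.1.1.2) :=
    (Computable.fst.comp (Computable.unpair.comp Computable.snd)).pair
      (Computable.snd.comp (Computable.fst.comp Computable.fst))
  have h1 : Computable fun p : ((ℕ × ℕ) × (List ℕ × ℕ)) × ℕ => scaledRadius p.1.1.1 p.2 :=
    (computable_scaledRadius.comp (hN.pair Computable.snd) :)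
  have h2 : Computable fun p : ((ℕ × ℕ) × (List ℕ × ℕ)) × ℕ =>
      A ((p.2.unpair.1, p.1.1.2), p.1.1.1) := hA.comp (hi.pair hN)
  have h3 : Computable₂ fun (p : (ℕ × ℕ) × (List ℕ × ℕ)) (n : ℕ) =>
      scaledRadius p.1.1 n - A ((n.unpair.1, p.1.2), p.1.1) :=
    Primrec.nat_sub.to_comp.comp h1 h2
  have h4 := Computable.list_map_sum (l := fun p : (ℕ × ℕ) × (List ℕ × ℕ) => p.2.1)
    (Computable.fst.comp Computable.snd) h3
  have h5 : Computable fun p : (ℕ × ℕ) × (List ℕ × ℕ) => p.2.2 :=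
    Computable.snd.comp Computable.snd
  have h6 : Computable fun p : (ℕ × ℕ) × (List ℕ × ℕ) => p.1.1 + 1 :=
    Computable.succ.comp (Computable.fst.comp Computable.fst)
  exact Primrec.nat_min.to_comp.comp h6 (Primrec.nat_mul.to_comp.comp h5 h4)

theorem computable_bumpSumApprox (hA : Computable A) :
    Computable fun p : (ℕ × ℕ) × List (List ℕ × ℕ) => bumpSumApprox A p.1.1 p.1.2 p.2 := by
  have h0 : Computable fun q : ((ℕ × ℕ) × List (List ℕ × ℕ)) × (List ℕ × ℕ) => (q.1.1, q.2) :=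
    (Computable.fst.comp Computable.fst).pair Computable.snd
  have h : Computable₂ fun (p : (ℕ × ℕ) × List (List ℕ × ℕ)) (u : List ℕ × ℕ) =>
      bumpApprox A p.1.1 p.1.2 u := ((computable_bumpApprox hA).comp h0 :)
  exact Computable.list_map_sum Computable.snd h

theorem computable_bumpSumLip : Computable bumpSumLip := by
  have h : Computable bumpLip := Primrec.nat_mul.to_comp.comp
    Computable.snd (Computable.list_length.comp Computable.fst)
  exact Computable.list_map_sum Computable.id (h.comp Computable.snd)

/-- Whether the bump sums `P < Q` on the ideal ball `n`, as verified at its centre with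
precision `1 / (N + 1)`. -/
def bumpSumLtTest (A : (ℕ × ℕ) × ℕ → ℕ) (n : ℕ) (t : List (List ℕ × ℕ) × List (List ℕ × ℕ))
    (N : ℕ) : Bool :=
  decide (bumpSumApprox A N n.unpair.1 t.1
    + (bumpSumLip t.1 + bumpSumLip t.2) * (scaledRadius N n + 3)
    < bumpSumApprox A N n.unpair.1 t.2)

theorem computable_bumpSumLtTest (hA : Computable A) :
    Computable₂ fun (p : ℕ × (List (List ℕ × ℕ) × List (List ℕ × ℕ))) (N : ℕ) =>
      bumpSumLtTest A p.1 p.2 N := by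
  have h0 : Computable fun q : (ℕ × (List (List ℕ × ℕ) × List (List ℕ × ℕ))) × ℕ =>
      (q.2, q.1.1.unpair.1) := Computable.snd.pair
    (Computable.fst.comp (Computable.unpair.comp (Computable.fst.comp Computable.fst)))
  have h1 : Computable fun q : (ℕ × (List (List ℕ × ℕ) × List (List ℕ × ℕ))) × ℕ => q.1.2.1 :=
    Computable.fst.comp (Computable.snd.comp Computable.fst)
  have h2 : Computable fun q : (ℕ × (List (List ℕ × ℕ) × List (List ℕ × ℕ))) × ℕ => q.1.2.2 :=
    Computable.snd.comp (Computable.snd.comp Computable.fst)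
  have h3 := (computable_bumpSumApprox hA).comp (h0.pair h1)
  have h4 := (computable_bumpSumApprox hA).comp (h0.pair h2)
  have h5 := Primrec.nat_add.to_comp.comp (computable_bumpSumLip.comp h1)
    (computable_bumpSumLip.comp h2)
  have h6 : Computable fun q : (ℕ × (List (List ℕ × ℕ) × List (List ℕ × ℕ))) × ℕ =>
      (q.2, q.1.1) := Computable.snd.pair (Computable.fst.comp Computable.fst)
  have h7 := Primrec.nat_add.to_comp.comp (computable_scaledRadius.comp h6) (Computable.const 3)
  exact Primrec.nat_lt.decide.to_comp.comp (Primrec.nat_add.to_comp.comp h3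
    (Primrec.nat_mul.to_comp.comp h5 h7)) h4

theorem lt_of_bumpSumLtTest
    (hA : ∀ i j N : ℕ, |(A ((i, j), N) : ℝ) - (N + 1) * dist (S.pt i) (S.pt j)| ≤ 1)
    {n N : ℕ} {t : List (List ℕ × ℕ) × List (List ℕ × ℕ)} (h : bumpSumLtTest A n t N = true)
    {x : X} (hx : x ∈ S.idealBall n) : S.bumpSum t.1 x < S.bumpSum t.2 x := by
  have hN : (0 : ℝ) < (N : ℝ) + 1 := by positivity
  have h0 : (bumpSumApprox A N n.unpair.1 t.1 : ℝ)
      + (bumpSumLip t.1 + bumpSumLip t.2) * (scaledRadius N n + 3)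
      < bumpSumApprox A N n.unpair.1 t.2 := by
    exact_mod_cast of_decide_eq_true h
  have h1 := abs_le.1 (S.abs_bumpSumApprox_sub_le hA N n.unpair.1 t.1)
  have h2 := abs_le.1 (S.abs_bumpSumApprox_sub_le hA N n.unpair.1 t.2)
  have h3 := abs_le.1 (S.bumpSum_lipschitz t.1 (S.pt n.unpair.1) x)
  have h4 := abs_le.1 (S.bumpSum_lipschitz t.2 (S.pt n.unpair.1) x)
  have h5 := S.mem_idealBall.1 hx
  have h6 := lt_scaledRadius N n
  -- Rounding the radius costs 1 here; with the 2 from the approximations at the centre this makes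
  -- the `3` of the test.
  have h7 : (N + 1) * dist (S.pt n.unpair.1) x ≤ scaledRadius N n + 1 :=
    ((mul_le_mul_of_nonneg_left h5.le hN.le).trans h6.le)
  have h8 := mul_le_mul_of_nonneg_left h7 (Nat.cast_nonneg (α := ℝ) (bumpSumLip t.1))
  have h9 := mul_le_mul_of_nonneg_left h7 (Nat.cast_nonneg (α := ℝ) (bumpSumLip t.2))
  have h10 := mul_le_mul_of_nonneg_left h3.1 hN.le
  have h11 := mul_le_mul_of_nonneg_left h4.2 hN.le
  refine lt_of_mul_lt_mul_left ?_ hN.le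
  nlinarith [h1.1, h1.2, h2.1, h2.2]

theorem exists_bumpSumLtTest
    (hA : ∀ i j N : ℕ, |(A ((i, j), N) : ℝ) - (N + 1) * dist (S.pt i) (S.pt j)| ≤ 1)
    {t : List (List ℕ × ℕ) × List (List ℕ × ℕ)}
    {x : X} (hx : S.bumpSum t.1 x < S.bumpSum t.2 x) :
    ∃ n N, x ∈ S.idealBall n ∧ bumpSumLtTest A n t N = true := by
  set L : ℝ := (bumpSumLip t.1 : ℝ) + bumpSumLip t.2 with hL
  have hL0 : 0 ≤ L := by positivity
  -- The radius is small enough to absorb the variation twice: once from `x` to the centre, once for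
  -- the ball term in the test.
  obtain ⟨b, hb⟩ := exists_nat_gt (2 * L / (S.bumpSum t.2 x - S.bumpSum t.1 x))
  have hb' : 2 * L * (1 / ((b : ℝ) + 1)) < S.bumpSum t.2 x - S.bumpSum t.1 x := by
    rw [div_lt_iff₀ (sub_pos.2 hx)] at hb
    rw [mul_one_div, div_lt_iff₀ (by positivity)]
    nlinarith
  obtain ⟨i, hi⟩ := S.dense.exists_dist_lt x (ε := 1 / ((b : ℝ) + 1)) (by positivity)
  set n := Nat.pair i (Nat.pair 0 b) with hn
  have hni : n.unpair.1 = i := by simp [hn]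
  have hr : ballRadius n = 1 / ((b : ℝ) + 1) := by simp [ballRadius_eq, hn]
  rw [dist_comm] at hi
  have h3 := abs_le.1 (S.bumpSum_lipschitz t.1 (S.pt i) x)
  have h4 := abs_le.1 (S.bumpSum_lipschitz t.2 (S.pt i) x)
  have hlt : S.bumpSum t.1 (S.pt i) + L * ballRadius n < S.bumpSum t.2 (S.pt i) := by
    have e1 := mul_le_mul_of_nonneg_left hi.le (Nat.cast_nonneg (α := ℝ) (bumpSumLip t.1))
    have e2 := mul_le_mul_of_nonneg_left hi.le (Nat.cast_nonneg (α := ℝ) (bumpSumLip t.2))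
    rw [hr]
    linarith [h3.1, h3.2, h4.1, h4.2]
  -- `5 * L` is `2 * L` for the approximation errors plus `3 * L` for the margin in the test.
  obtain ⟨N, hN⟩ := exists_nat_gt (5 * L /
    (S.bumpSum t.2 (S.pt i) - (S.bumpSum t.1 (S.pt i) + L * ballRadius n)))
  refine ⟨n, N, S.mem_idealBall.2 (by rwa [hni, hr]), decide_eq_true ?_⟩
  rw [div_lt_iff₀ (sub_pos.2 hlt)] at hN
  have h1 := abs_le.1 (S.abs_bumpSumApprox_sub_le hA N i t.1)
  have h2 := abs_le.1 (S.abs_bumpSumApprox_sub_le hA N i t.2)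
  have h5 := mul_le_mul_of_nonneg_left (scaledRadius_le N n) hL0
  rw [hni]
  have : (bumpSumApprox A N i t.1 : ℝ) + L * (scaledRadius N n + 3)
      < bumpSumApprox A N i t.2 := by nlinarith [h1.1, h1.2, h2.1, h2.2]
  rw [hL] at this
  exact_mod_cast this

end Approx

theorem continuous_bump (u : List ℕ × ℕ) : Continuous (S.bump u) :=
  (LipschitzWith.of_dist_le_mul (K := bumpLip u) fun x y => by
    simpa [Real.dist_eq] using S.bump_lipschitz u x y).continuous

/-- The doubled ball leaves room for a bump that equals 1 on the ideal ball and is still supported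
in `G`. -/
theorem exists_mem_idealBall_subset {x : X} {G : Set X} (hG : IsOpen G) (hx : x ∈ G) :
    ∃ n, x ∈ S.idealBall n ∧ Metric.ball (S.pt n.unpair.1) (2 * ballRadius n) ⊆ G := by
  obtain ⟨ε, hε, hsub⟩ := Metric.isOpen_iff.1 hG x hx
  obtain ⟨b, hb⟩ := exists_nat_one_div_lt (show 0 < ε / 3 by positivity)
  obtain ⟨i, hi⟩ := S.dense.exists_dist_lt x (ε := 1 / ((b : ℝ) + 1)) (by positivity)
  have hr : ballRadius (Nat.pair i (Nat.pair 0 b)) = 1 / ((b : ℝ) + 1) := by simp [ballRadius_eq]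
  refine ⟨Nat.pair i (Nat.pair 0 b), ?_, ?_⟩
  · rw [mem_idealBall, hr, dist_comm]
    simpa using hi
  · rw [hr, Nat.unpair_pair]
    refine fun y hy => hsub ?_
    rw [Metric.mem_ball] at hy ⊢
    have := dist_triangle y (S.pt i) x
    rw [dist_comm (S.pt i) x] at this
    simp only at hy
    linarith

theorem isOpen_idealBall (n : ℕ) : IsOpen (S.idealBall n) := Metric.isOpen_ball

/-- A compact set covered by ideal balls of some kind is covered by a finite list of them. -/
theorem exists_list_cover {F : Set X} (hF : IsCompact F) {p : ℕ → Prop}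
    (h : ∀ x ∈ F, ∃ n, p n ∧ x ∈ S.idealBall n) :
    ∃ l : List ℕ, (∀ n ∈ l, p n) ∧ F ⊆ ⋃ n ∈ l, S.idealBall n := by
  obtain ⟨t, ht, hcov⟩ := hF.elim_finite_subcover_image (b := {n | p n})
    (c := S.idealBall) (fun n _ => S.isOpen_idealBall n) fun x hx => by
      obtain ⟨n, hn, hx⟩ := h x hx
      exact mem_biUnion (show n ∈ {n | p n} from hn) hx
  obtain ⟨ht', hcov⟩ := hcov
  refine ⟨ht'.toFinset.toList, fun n hn => ht (by simpa using hn), hcov.trans ?_⟩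
  intro x hx
  simpa using hx

/-- On a recursively compact space, strict inequality of bump sums is semi-decidable. -/
theorem rePred_bumpSum_lt (hX : S.RecursivelyCompact univ) :
    REPred fun t : List (List ℕ × ℕ) × List (List ℕ × ℕ) =>
      ∀ x, S.bumpSum t.1 x < S.bumpSum t.2 x := by
  obtain ⟨A, hA, hAd⟩ := S.exists_dist_approx
  have h1 : REPred fun p : ℕ × (List (List ℕ × ℕ) × List (List ℕ × ℕ)) =>
      ∃ N, bumpSumLtTest A p.1 p.2 N = true := .of_exists_stage (computable_bumpSumLtTest hA)
  have h0 : Computable fun r : ℕ × ((List (List ℕ × ℕ) × List (List ℕ × ℕ)) × List ℕ) =>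
      (r.1, r.2.1) := Computable.fst.pair (Computable.fst.comp Computable.snd)
  have h2 : REPred fun q : (List (List ℕ × ℕ) × List (List ℕ × ℕ)) × List ℕ =>
      ∀ n ∈ q.2, ∃ N, bumpSumLtTest A n q.1 N = true :=
    REPred.forall_mem (p := fun r : ℕ × ((List (List ℕ × ℕ) × List (List ℕ × ℕ)) × List ℕ) =>
      ∃ N, bumpSumLtTest A r.1 r.2.1 N = true)
      (h1.comp h0 :) Computable.snd
  -- The certificate is a finite cover of the space by balls each of which passes the test at some
  -- precision.
  refine ((hX.2.comp Computable.snd).and h2).exists_snd.of_eq fun t => ?_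
  constructor
  · rintro ⟨l, hl, h⟩ x
    obtain ⟨n, hn, hx⟩ := mem_iUnion₂.1 (hl (mem_univ x))
    obtain ⟨N, hN⟩ := h n hn
    exact S.lt_of_bumpSumLtTest hAd hN hx
  · intro h
    obtain ⟨l, hl, hcov⟩ := S.exists_list_cover hX.1
      (p := fun n => ∃ N, bumpSumLtTest A n t N = true) fun x _ => by
        obtain ⟨n, N, hx, hN⟩ := S.exists_bumpSumLtTest hAd (h x)
        exact ⟨n, ⟨N, hN⟩, hx⟩
    exact ⟨l, hcov, hl⟩

end ComputableMetricStructure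

/-! ### A theorem of the alternative for integrals of continuous functions. -/

section Duality

variable {X : Type*} [TopologicalSpace X] [CompactSpace X] [T2Space X]

/-- A positive nonzero functional on `C(X, ℝ)` is, up to scaling, a probability measure. -/
theorem exists_probabilityMeasure_integral_eq [MeasurableSpace X] [BorelSpace X]
    (Λ : C(X, ℝ) →ₗ[ℝ] ℝ) (hpos : ∀ g : C(X, ℝ), 0 ≤ g → 0 ≤ Λ g) (h1 : 0 < Λ 1) :
    ∃ ν : ProbabilityMeasure X, ∀ g : C(X, ℝ), ∫ x, g x ∂(ν : Measure X) = Λ g / Λ 1 := by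
  let Φ : CompactlySupportedContinuousMap X ℝ →ₗ[ℝ] ℝ :=
    { toFun := fun g => Λ g.toContinuousMap / Λ 1
      map_add' := fun g g' => by
        rw [← add_div, ← map_add]; rfl
      map_smul' := fun c g => by
        rw [RingHom.id_apply, smul_eq_mul, ← mul_div_assoc, ← smul_eq_mul, ← map_smul]; rfl }
  let Ψ : CompactlySupportedContinuousMap X ℝ →ₚ[ℝ] ℝ := PositiveLinearMap.mk₀ Φ fun g hg =>
    div_nonneg (hpos _ fun x => hg x) h1.le
  have hint : ∀ g : C(X, ℝ), ∫ x, g x ∂(RealRMK.rieszMeasure Ψ) = Λ g / Λ 1 := fun g =>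
    RealRMK.integral_rieszMeasure Ψ (CompactlySupportedContinuousMap.continuousMapEquiv g)
  have hprob : IsProbabilityMeasure (RealRMK.rieszMeasure Ψ) := by
    have h := hint 1
    rw [div_self h1.ne'] at h
    simp only [ContinuousMap.one_apply, integral_const, smul_eq_mul, mul_one] at h
    exact ⟨by simpa [Measure.real, ENNReal.toReal_eq_one_iff] using h⟩
  exact ⟨⟨RealRMK.rieszMeasure Ψ, hprob⟩, hint⟩

/-- Certificates are plain finite sums, so only an additive monoid is available. The elements with a
positive multiple in it are stable under rational scaling; approximating `r` by `⌊r n⌋ / n` makes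
their closure stable under real scaling, a genuine cone for Hahn–Banach. -/
theorem smul_mem_closure_setOf_nsmul_mem {E : Type*} [AddCommGroup E] [Module ℝ E]
    [TopologicalSpace E] [ContinuousSMul ℝ E] (A : AddSubmonoid E) {r : ℝ} (hr : 0 ≤ r) {x : E}
    (hx : x ∈ closure {b : E | ∃ n : ℕ, (n + 1) • b ∈ A}) :
    r • x ∈ closure {b : E | ∃ n : ℕ, (n + 1) • b ∈ A} := by
  rw [← closure_closure]
  refine map_mem_closure (continuous_const_smul r) hx fun b ⟨m, hm⟩ => ?_
  have hlim : Tendsto (fun n : ℕ => ((⌊r * (n : ℝ)⌋₊ : ℝ) / n) • b) atTop (𝓝 (r • b)) :=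
    ((tendsto_nat_floor_mul_div_atTop hr).comp tendsto_natCast_atTop_atTop).smul_const b
  refine mem_closure_of_tendsto hlim ?_
  filter_upwards [eventually_gt_atTop 0] with n hn
  obtain ⟨k, rfl⟩ := Nat.exists_eq_succ_of_ne_zero hn.ne'
  refine ⟨(k + 1) * (m + 1) - 1, ?_⟩
  have hk : ((k + 1) * (m + 1) - 1 + 1) = (m + 1) * (k + 1) := by
    rw [Nat.sub_add_cancel (Nat.mul_pos k.succ_pos m.succ_pos), mul_comm]
  have : (k + 1) • (((⌊r * ((k + 1 : ℕ) : ℝ)⌋₊ : ℝ) / (k + 1 : ℕ)) • b)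
      = ⌊r * ((k + 1 : ℕ) : ℝ)⌋₊ • b := by
    rw [← Nat.cast_smul_eq_nsmul ℝ, ← Nat.cast_smul_eq_nsmul ℝ, smul_smul,
      mul_div_cancel₀ _ (by positivity)]
  rw [Nat.succ_eq_add_one, hk, mul_smul, this, smul_comm]
  exact A.nsmul_mem hm _

/-- Theorem of the alternative: if no finite sum of members of `H` is everywhere positive, then some
probability measure integrates all members of `H` to nonpositive numbers. -/
theorem exists_list_sum_pos_of_forall_integral_pos [Nonempty X] [MeasurableSpace X] [BorelSpace X]
    (H : Set C(X, ℝ))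
    (h : ∀ ν : ProbabilityMeasure X, ∃ g ∈ H, 0 < ∫ x, g x ∂(ν : Measure X)) :
    ∃ l : List C(X, ℝ), (∀ g ∈ l, g ∈ H) ∧ ∀ x, 0 < l.sum x := by
  by_contra hcon
  let A := AddSubmonoid.closure H
  let P : Set C(X, ℝ) := {g | ∀ x, 0 < g x}
  let B : Set C(X, ℝ) := {b | ∃ n : ℕ, (n + 1) • b ∈ A}
  have hPopen : IsOpen P := by
    have : P = {g : C(X, ℝ) | MapsTo g univ (Ioi 0)} := by
      ext g; simp [P, MapsTo]
    rw [this]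
    exact ContinuousMap.isOpen_setOfPred_mapsTo isCompact_univ isOpen_Ioi
  have hPconv : Convex ℝ P := by
    intro g hg g' hg' a b ha hb hab x
    have h1 := hg x
    have h2 := hg' x
    simp only [ContinuousMap.add_apply, ContinuousMap.smul_apply, smul_eq_mul]
    rcases ha.eq_or_lt with rfl | ha'
    · obtain rfl : b = 1 := by linarith
      simpa using h2
    · have := mul_pos ha' h1
      have := mul_nonneg hb h2.le
      linarith
  -- A positive function with a multiple in `A` would make a finite sum from `H` positive. As `P` is
  -- open, it misses the closure of `B` too.
  have hdisj : Disjoint P (closure B) := by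
    refine Disjoint.closure_right ?_ hPopen
    rw [Set.disjoint_left]
    rintro g hg ⟨n, hn⟩
    obtain ⟨l, hl, hsum⟩ := AddSubmonoid.exists_list_of_mem_closure hn
    refine hcon ⟨l, hl, fun x => ?_⟩
    rw [hsum, ← Nat.cast_smul_eq_nsmul ℝ, ContinuousMap.smul_apply, smul_eq_mul]
    have := hg x
    positivity
  have hBadd : ∀ {b}, b ∈ closure B → ∀ {b'}, b' ∈ closure B → b + b' ∈ closure B := by
    intro b hb b' hb'
    refine map_mem_closure₂ continuous_add hb hb' ?_
    rintro c ⟨n, hn⟩ c' ⟨m, hm⟩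
    refine ⟨(n + 1) * (m + 1) - 1, ?_⟩
    rw [Nat.sub_add_cancel (Nat.mul_pos n.succ_pos m.succ_pos), smul_add]
    refine A.add_mem ?_ ?_
    · rw [mul_comm, mul_smul]; exact A.nsmul_mem hn _
    · rw [mul_smul]; exact A.nsmul_mem hm _
  have hBconv : Convex ℝ (closure B) := fun g hg g' hg' a b ha hb _ =>
    hBadd (smul_mem_closure_setOf_nsmul_mem A ha hg) (smul_mem_closure_setOf_nsmul_mem A hb hg')
  obtain ⟨f, u, hfP, hfB⟩ := geometric_hahn_banach_open hPconv hPopen hBconv hdisj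
  have hB0 : (0 : C(X, ℝ)) ∈ closure B := subset_closure ⟨0, by simp⟩
  have hu : u ≤ 0 := by simpa using hfB 0 hB0
  have hfB0 : ∀ b ∈ closure B, 0 ≤ f b := by
    intro b hb
    by_contra hneg
    push Not at hneg
    -- The factor rescales `b` so that `f` takes the value `u - 1`, below the bound `u`.
    have h2 := hfB _ (smul_mem_closure_setOf_nsmul_mem A (r := (u - 1) / f b)
      (div_nonneg_of_nonpos (by linarith) hneg.le) hb)
    rw [map_smul, smul_eq_mul, div_mul_cancel₀ _ hneg.ne] at h2
    linarith
  have hfP0 : ∀ g ∈ P, f g < 0 := fun g hg => (hfP g hg).trans_le hu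
  have h1 : f 1 < 0 := hfP0 1 fun x => by simp
  have hpos : ∀ g : C(X, ℝ), 0 ≤ g → 0 ≤ -f g := by
    intro g hg
    by_contra hneg
    push Not at hneg
    -- Adding this positive constant puts `g` in `P` but only halves the positive number `f g`.
    have h2 : f (g + (f g / (-f 1) / 2) • (1 : C(X, ℝ))) < 0 := by
      refine hfP0 _ fun x => ?_
      have h3 : 0 ≤ g x := hg x
      have h4 : 0 < f g / (-f 1) / 2 := by
        have : 0 < f g := by linarith
        have : 0 < -f 1 := by linarith
        positivity
      simp only [ContinuousMap.add_apply, ContinuousMap.smul_apply, ContinuousMap.one_apply,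
        smul_eq_mul, mul_one]
      linarith
    rw [map_add, map_smul, smul_eq_mul] at h2
    have h5 : f g / (-f 1) / 2 * f 1 = - f g / 2 := by
      rw [div_neg, neg_div, neg_mul, div_right_comm, div_mul_cancel₀ _ h1.ne, neg_div]
    linarith
  -- Normalised, `-f` is a probability measure whose integral is nonpositive on all of `H`, against
  -- `h`.
  obtain ⟨ν, hν⟩ := exists_probabilityMeasure_integral_eq (-(f : C(X, ℝ) →ₗ[ℝ] ℝ))
    (fun g hg => by simpa using hpos g hg) (by simpa using h1)
  obtain ⟨g, hgH, hg⟩ := h ν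
  rw [hν] at hg
  have h6 := hfB0 g (subset_closure ⟨0, by simpa using AddSubmonoid.subset_closure hgH⟩)
  have h7 : (-(f : C(X, ℝ) →ₗ[ℝ] ℝ)) g / (-(f : C(X, ℝ) →ₗ[ℝ] ℝ)) 1 ≤ 0 :=
    div_nonpos_of_nonpos_of_nonneg (by simpa using h6) (by simpa using h1.le)
  linarith

end Duality

/-! ### Integral inequalities at the unique solution of a system of tests. -/

namespace REPred

variable {α β : Type*} [Primcodable α] [Primcodable β]

theorem eq_of_computable {f g : α → β} (hf : Computable f) (hg : Computable g) :
    REPred fun a => f a = g a := by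
  classical
  have h : Computable fun a => decide (f a = g a) := Primrec.eq.decide.to_comp.comp hf hg
  exact (of_bool h).of_eq fun a => by simp

theorem mem_list {l : α → List β} {f : α → β} (hl : Computable l) (hf : Computable f) :
    REPred fun a => f a ∈ l a := by
  have h1 : Computable fun p : α × ℕ => (l p.1)[p.2]? :=
    Computable.list_getElem?.comp (hl.comp Computable.fst) Computable.snd
  have h2 : Computable fun p : α × ℕ => some (f p.1) :=
    Computable.option_some.comp (hf.comp Computable.fst)
  exact (eq_of_computable h1 h2).exists_snd.of_eq fun a =>
    (List.mem_iff_getElem? (a := f a) (l := l a)).symm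

end REPred

namespace ComputableMetricStructure

variable {X : Type*} [MetricSpace X] (S : ComputableMetricStructure X)

theorem bump_nonneg (u : List ℕ × ℕ) (x : X) : 0 ≤ S.bump u x :=
  le_min zero_le_one (mul_nonneg (Nat.cast_nonneg _) (List.sum_nonneg fun y hy => by
    obtain ⟨n, -, rfl⟩ := List.mem_map.1 hy
    exact le_max_left _ _))

theorem bump_le_one (u : List ℕ × ℕ) (x : X) : S.bump u x ≤ 1 := min_le_left _ _

theorem bump_eq_zero {u : List ℕ × ℕ} {x : X} (h : ∀ n ∈ u.1, x ∉ S.idealBall n) :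
    S.bump u x = 0 := by
  have : (u.1.map fun n => max 0 (ballRadius n - dist (S.pt n.unpair.1) x)).sum = 0 := by
    refine List.sum_eq_zero fun y hy => ?_
    obtain ⟨n, hn, rfl⟩ := List.mem_map.1 hy
    have := h n hn
    rw [mem_idealBall, not_lt] at this
    exact max_eq_left (by linarith)
  simp [bump, this]

theorem bump_eq_one {u : List ℕ × ℕ} {x : X} {n : ℕ} (hn : n ∈ u.1)
    (h : 1 ≤ u.2 * (ballRadius n - dist (S.pt n.unpair.1) x)) : S.bump u x = 1 := by
  refine min_eq_left (h.trans ?_)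
  gcongr
  refine (le_max_right 0 _).trans (List.single_le_sum (fun y hy => ?_) _ (List.mem_map_of_mem hn))
  obtain ⟨n, -, rfl⟩ := List.mem_map.1 hy
  exact le_max_left _ _

theorem continuous_bumpSum (P : List (List ℕ × ℕ)) : Continuous (S.bumpSum P) :=
  (LipschitzWith.of_dist_le_mul (K := bumpSumLip P) fun x y => by
    simpa [Real.dist_eq] using S.bumpSum_lipschitz P x y).continuous

@[simp]
theorem bumpSum_nil (x : X) : S.bumpSum [] x = 0 := rfl

theorem bumpSum_append (P Q : List (List ℕ × ℕ)) (x : X) :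
    S.bumpSum (P ++ Q) x = S.bumpSum P x + S.bumpSum Q x := by
  simp [bumpSum]

@[simp]
theorem bumpSum_singleton (u : List ℕ × ℕ) (x : X) : S.bumpSum [u] x = S.bump u x := by
  simp [bumpSum]

@[simp]
theorem bumpSum_replicate (n : ℕ) (u : List ℕ × ℕ) (x : X) :
    S.bumpSum (List.replicate n u) x = n * S.bump u x := by
  simp [bumpSum]

theorem bumpSum_flatMap {β : Type*} (l : List β) (f : β → List (List ℕ × ℕ)) (x : X) :
    S.bumpSum (l.flatMap f) x = (l.map fun b => S.bumpSum (f b) x).sum := by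
  induction l with
  | nil => simp
  | cons b l ih => simp [bumpSum_append, ih]

variable [CompactSpace X] [MeasurableSpace X] [BorelSpace X]

theorem integrable_bump (u : List ℕ × ℕ) (ν : Measure X) [IsFiniteMeasure ν] :
    Integrable (S.bump u) ν :=
  (S.continuous_bump u).integrable_of_hasCompactSupport (HasCompactSupport.of_compactSpace _)

theorem integrable_bumpSum (P : List (List ℕ × ℕ)) (ν : Measure X) [IsFiniteMeasure ν] :
    Integrable (S.bumpSum P) ν :=
  (S.continuous_bumpSum P).integrable_of_hasCompactSupport (HasCompactSupport.of_compactSpace _)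

/-- The inequality `∫ ∑ P dν ≤ ∫ ∑ Q dν` between the integrals of two sums of bump functions. -/
def SatisfiesTest (ν : ProbabilityMeasure X) (t : List (List ℕ × ℕ) × List (List ℕ × ℕ)) : Prop :=
  ∫ x, S.bumpSum t.1 x ∂(ν : Measure X) ≤ ∫ x, S.bumpSum t.2 x ∂(ν : Measure X)

/-- If `μ` is the only solution of a recursively enumerable system of inequalities between integrals
of bump sums, then strict inequalities between integrals of bump sums are semi-decidable at `μ`. -/
theorem rePred_integral_lt (hX : S.RecursivelyCompact univ)
    {E : List (List ℕ × ℕ) × List (List ℕ × ℕ) → Prop} (hE : REPred E)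
    (μ : ProbabilityMeasure X) (hμ : ∀ t, E t → S.SatisfiesTest μ t)
    (huniq : ∀ ν : ProbabilityMeasure X, (∀ t, E t → S.SatisfiesTest ν t) → ν = μ) :
    REPred fun t : List (List ℕ × ℕ) × List (List ℕ × ℕ) =>
      ∫ x, S.bumpSum t.1 x ∂(μ : Measure X) < ∫ x, S.bumpSum t.2 x ∂(μ : Measure X) := by
  let 𝕋 := List (List ℕ × ℕ) × List (List ℕ × ℕ)
  have : Nonempty X := μ.nonempty
  have hswap : Computable fun p : 𝕋 × (𝕋 × List 𝕋) => (p.2.1.2, p.2.1.1) :=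
    (Computable.snd.comp (Computable.fst.comp Computable.snd)).pair
      (Computable.fst.comp (Computable.fst.comp Computable.snd))
  -- A certificate may use the tests of `E` and the reversal of the inequality under examination.
  have h1 : REPred fun p : 𝕋 × (𝕋 × List 𝕋) => E p.1 ∨ p.1 = (p.2.1.2, p.2.1.1) :=
    (hE.comp Computable.fst).or (REPred.eq_of_computable Computable.fst hswap)
  have h2 : REPred fun p : 𝕋 × List 𝕋 => ∀ s ∈ p.2, E s ∨ s = (p.1.2, p.1.1) :=
    REPred.forall_mem h1 Computable.snd
  have h3 : Primrec fun p : 𝕋 × List 𝕋 => p.2.flatMap Prod.snd :=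
    Primrec.list_flatMap Primrec.snd (Primrec.snd.comp Primrec.snd)
  have h4 : Primrec fun p : 𝕋 × List 𝕋 => p.2.flatMap Prod.fst :=
    Primrec.list_flatMap Primrec.snd (Primrec.fst.comp Primrec.snd)
  have h5 := (S.rePred_bumpSum_lt hX).comp (h3.to_comp.pair h4.to_comp)
  refine (h2.and h5).exists_snd.of_eq fun t => ?_
  simp only [bumpSum_flatMap]
  constructor
  · rintro ⟨l, hl, hpos⟩
    by_contra! hle
    -- If the reversed test held at `μ`, all tests in `l` would; summing them contradicts the
    -- pointwise strict inequality.
    have hl' : ∀ s ∈ l, S.SatisfiesTest μ s := by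
      intro s hs
      rcases hl s hs with h | rfl
      · exact hμ s h
      · exact hle
    have hint : ∀ f : 𝕋 → List (List ℕ × ℕ), ∫ x, (l.map fun b => S.bumpSum (f b) x).sum ∂(μ : Measure X)
        = (l.map fun b => ∫ x, S.bumpSum (f b) x ∂(μ : Measure X)).sum := by
      intro f
      clear hl hpos hl'
      induction l with
      | nil => simp
      | cons b l ih =>
        simp only [List.map_cons, List.sum_cons]
        rw [integral_add (S.integrable_bumpSum _ _), ih]
        simp only [← bumpSum_flatMap]
        exact S.integrable_bumpSum _ _
    have hlt : ∫ x, (l.map fun b => S.bumpSum b.2 x).sum ∂(μ : Measure X)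
        < ∫ x, (l.map fun b => S.bumpSum b.1 x).sum ∂(μ : Measure X) := by
      simp only [← bumpSum_flatMap] at hpos ⊢
      rw [← sub_pos, ← integral_sub (S.integrable_bumpSum _ _) (S.integrable_bumpSum _ _),
        integral_pos_iff_support_of_nonneg (fun x => sub_nonneg.2 (hpos x).le)
          ((S.integrable_bumpSum _ _).sub (S.integrable_bumpSum _ _))]
      have : Function.support (fun x => S.bumpSum (l.flatMap fun b => b.1) x
          - S.bumpSum (l.flatMap fun b => b.2) x) = univ := by
        ext x
        simpa using (sub_pos.2 (hpos x)).ne'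
      rw [this]
      simp
    rw [hint, hint] at hlt
    exact hlt.not_ge (List.sum_le_sum fun s hs => hl' s hs)
  · intro hlt
    let g : 𝕋 → C(X, ℝ) := fun s =>
      ⟨fun x => S.bumpSum s.1 x - S.bumpSum s.2 x,
        (S.continuous_bumpSum _).sub (S.continuous_bumpSum _)⟩
    have hg : ∀ (ν : ProbabilityMeasure X) s, ∫ x, g s x ∂(ν : Measure X)
        = ∫ x, S.bumpSum s.1 x ∂(ν : Measure X) - ∫ x, S.bumpSum s.2 x ∂(ν : Measure X) :=
      fun ν s => integral_sub (S.integrable_bumpSum _ _) (S.integrable_bumpSum _ _)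
    -- No `ν` satisfies the enlarged system: the tests of `E` force `ν = μ`, where the reversed one
    -- fails.
    obtain ⟨L, hL, hpos⟩ := exists_list_sum_pos_of_forall_integral_pos
      (g '' {s | E s ∨ s = (t.2, t.1)}) fun ν => by
        by_contra! hcon
        obtain rfl := huniq ν fun s hs => by
          have := hcon _ (mem_image_of_mem g (Or.inl hs))
          rw [hg] at this
          exact sub_nonpos.1 this
        have := hcon _ (mem_image_of_mem g (Or.inr rfl))
        rw [hg] at this
        linarith
    have hlift : ∃ l : List 𝕋, (∀ s ∈ l, E s ∨ s = (t.2, t.1)) ∧ L = l.map g := by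
      clear hpos
      induction L with
      | nil => exact ⟨[], by simp, rfl⟩
      | cons a L ih =>
        obtain ⟨l, hl, rfl⟩ := ih fun b hb => hL b (List.mem_cons_of_mem _ hb)
        obtain ⟨s, hs, rfl⟩ := hL a List.mem_cons_self
        refine ⟨s :: l, fun r hr => ?_, rfl⟩
        rcases List.mem_cons.1 hr with rfl | hr
        · exact hs
        · exact hl r hr
    obtain ⟨l, hl, rfl⟩ := hlift
    refine ⟨l, hl, fun x => ?_⟩
    have hsum : (l.map g).sum x = (l.map fun b => S.bumpSum b.1 x).sum
        - (l.map fun b => S.bumpSum b.2 x).sum := by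
      clear hl hL hpos
      induction l with
      | nil => simp
      | cons s l ih =>
        simp only [List.map_cons, List.sum_cons, ContinuousMap.add_apply, ih]
        simp only [g, ContinuousMap.coe_mk]
        ring
    have := hpos x
    rw [hsum] at this
    exact sub_pos.1 this

theorem integral_bump_le (u : List ℕ × ℕ) (ν : Measure X) [IsFiniteMeasure ν] {G : Set X}
    (hG : ∀ n ∈ u.1, S.idealBall n ⊆ G) (hGm : MeasurableSet G) :
    ∫ x, S.bump u x ∂ν ≤ ν.real G := by
  rw [← integral_indicator_one hGm]
  refine integral_mono (S.integrable_bump u ν) ((integrable_const 1).indicator hGm) fun x => ?_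
  by_cases hx : x ∈ G
  · rw [indicator_of_mem hx]
    exact S.bump_le_one u x
  · rw [indicator_of_notMem hx, S.bump_eq_zero fun n hn hxn => hx (hG n hn hxn)]

theorem le_integral_bump (u : List ℕ × ℕ) (ν : Measure X) [IsFiniteMeasure ν] {F : Set X}
    (hF : ∀ x ∈ F, S.bump u x = 1) (hFm : MeasurableSet F) :
    ν.real F ≤ ∫ x, S.bump u x ∂ν := by
  rw [← integral_indicator_one hFm]
  refine integral_mono ((integrable_const 1).indicator hFm) (S.integrable_bump u ν) fun x => ?_
  by_cases hx : x ∈ F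
  · rw [indicator_of_mem hx, hF x hx]; rfl
  · rw [indicator_of_notMem hx]
    exact S.bump_nonneg u x

/-- The measure of a union of ideal balls is approximated from below by integrals of bump functions
supported in these balls. -/
theorem exists_lt_integral_bump (ν : Measure X) [IsFiniteMeasure ν] (p : ℕ → Prop) {c : ℝ}
    (hc : c < ν.real (⋃ (n : ℕ) (_ : p n), S.idealBall n)) :
    ∃ u : List ℕ × ℕ, (∀ n ∈ u.1, p n) ∧ c < ∫ x, S.bump u x ∂ν := by
  have hopen : IsOpen (⋃ (n : ℕ) (_ : p n), S.idealBall n) :=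
    isOpen_iUnion fun n => isOpen_iUnion fun _ => S.isOpen_idealBall n
  have hFex : ∃ F ⊆ ⋃ (n : ℕ) (_ : p n), S.idealBall n, IsCompact F ∧ c < ν.real F := by
    rcases lt_or_ge c 0 with hc0 | hc0
    · exact ⟨∅, empty_subset _, isCompact_empty, by simpa⟩
    · obtain ⟨F, hFs, hF, hlt⟩ := hopen.exists_lt_isCompact (μ := ν) (r := ENNReal.ofReal c)
        ((ENNReal.ofReal_lt_iff_lt_toReal hc0 (measure_ne_top _ _)).2 hc)
      exact ⟨F, hFs, hF, (ENNReal.ofReal_lt_iff_lt_toReal hc0 (measure_ne_top _ _)).1 hlt⟩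
  obtain ⟨F, hFs, hF, hlt⟩ := hFex
  obtain ⟨l, hl, hcov⟩ := S.exists_list_cover hF (p := p) fun x hx => by
    simpa using hFs hx
  let s : X → ℝ := fun x => (l.map fun n => max 0 (ballRadius n - dist (S.pt n.unpair.1) x)).sum
  have hs : Continuous s := by
    have : ∀ l : List ℕ, Continuous fun x : X =>
        (l.map fun n => max 0 (ballRadius n - dist (S.pt n.unpair.1) x)).sum := by
      intro l
      induction l with
      | nil => simpa using continuous_const
      | cons n l ih =>
        simp only [List.map_cons, List.sum_cons]
        exact (by fun_prop : Continuous fun x : X =>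
          max 0 (ballRadius n - dist (S.pt n.unpair.1) x)).add ih
    exact this l
  have hspos : ∀ x ∈ F, 0 < s x := by
    intro x hx
    obtain ⟨n, hn, hxn⟩ := mem_iUnion₂.1 (hcov hx)
    rw [mem_idealBall] at hxn
    refine (lt_max_of_lt_right (sub_pos.2 hxn)).trans_le
      (List.single_le_sum (fun y hy => ?_) _ (List.mem_map_of_mem hn))
    obtain ⟨n, -, rfl⟩ := List.mem_map.1 hy
    exact le_max_left _ _
  obtain ⟨δ, hδ, hδF⟩ : ∃ δ > 0, ∀ x ∈ F, δ ≤ s x := by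
    rcases F.eq_empty_or_nonempty with rfl | hne
    · exact ⟨1, one_pos, by simp⟩
    · obtain ⟨y, hy, hmin⟩ := hF.exists_isMinOn hne hs.continuousOn
      exact ⟨s y, hspos y hy, fun x hx => hmin hx⟩
  -- The slope `k` lifts the sum, which is at least `δ` on `F`, to at least 1 there.
  obtain ⟨k, hk⟩ := exists_nat_ge (1 / δ)
  refine ⟨(l, k), hl, hlt.trans_le (S.le_integral_bump _ _ (fun x hx => min_eq_left ?_)
    hF.measurableSet)⟩
  rw [div_le_iff₀ hδ] at hk
  exact hk.trans (mul_le_mul_of_nonneg_left (hδF x hx) (Nat.cast_nonneg k))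

end ComputableMetricStructure

/-! ### Regular measures and Hausdorff dimension. -/

theorem pos_of_dimH_lt {X : Type*} [MetricSpace X] {α : ℝ} {D : Set X} (hαD : (dimH D : EReal) < (α : EReal)) : 0 < α := by
  have h : ((0 : ℝ) : EReal) < (α : EReal) := (EReal.coe_ennreal_nonneg _).trans_lt hαD
  exact_mod_cast h

section Regularity

variable {X : Type*} [MetricSpace X] [MeasurableSpace X] {α K : ℝ} {ν : ProbabilityMeasure X}

theorem nonneg_of_mem_regMeasures (hν : ν ∈ regMeasures X α K) : 0 ≤ K := by
  have h : ((0 : ℝ) : EReal) ≤ (K : EReal) := (EReal.coe_ennreal_nonneg _).trans hν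
  exact_mod_cast h

theorem measureReal_ball_le (hν : ν ∈ regMeasures X α K) (x : X) {r : ℝ} (hr : 0 < r) :
    (ν : Measure X).real (Metric.ball x r) ≤ K * r ^ α := by
  have hK := nonneg_of_mem_regMeasures hν
  have h1 : regNorm α ν ≤ ENNReal.ofReal K := by
    rw [← EReal.coe_ennreal_le_coe_ennreal_iff, EReal.coe_ennreal_ofReal, max_eq_left hK]
    exact hν
  have h2 : (ν : Measure X) (Metric.ball x r) / ENNReal.ofReal (r ^ α) ≤ ENNReal.ofReal K :=
    le_trans (le_iSup_of_le x (le_iSup₂_of_le (f := fun r (_ : 0 < r) =>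
      (ν : Measure X) (Metric.ball x r) / ENNReal.ofReal (r ^ α)) r hr le_rfl)) h1
  have hpos := Real.rpow_pos_of_pos hr α
  rw [ENNReal.div_le_iff (by simpa using hpos) ENNReal.ofReal_ne_top,
    ← ENNReal.ofReal_mul hK] at h2
  exact ENNReal.toReal_le_of_le_ofReal (mul_nonneg hK hpos.le) h2

theorem mem_regMeasures_of_forall (hK : 0 ≤ K)
    (h : ∀ (x : X) (r : ℝ), 0 < r → (ν : Measure X).real (Metric.ball x r) ≤ K * r ^ α) :
    ν ∈ regMeasures X α K := by
  have h1 : regNorm α ν ≤ ENNReal.ofReal K := by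
    refine iSup_le fun x => iSup₂_le fun r hr => ?_
    have hpos := Real.rpow_pos_of_pos hr α
    rw [ENNReal.div_le_iff (by simpa using hpos) ENNReal.ofReal_ne_top, ← ENNReal.ofReal_mul hK,
      ENNReal.le_ofReal_iff_toReal_le (measure_ne_top _ _) (mul_nonneg hK hpos.le)]
    exact h x r hr
  rw [← EReal.coe_ennreal_le_coe_ennreal_iff, EReal.coe_ennreal_ofReal, max_eq_left hK] at h1
  exact h1

/-- Mass distribution principle: `ν / (K + 1)` is bounded by the Hausdorff measure of dimension `α`,
which is null on `D`. The constant is `K + 1` because `K` might be zero. -/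
theorem measure_eq_zero_of_dimH_lt [BorelSpace X] {D : Set X}
    (hαD : (dimH D : EReal) < (α : EReal)) (hν : ν ∈ regMeasures X α K) :
    (ν : Measure X) D = 0 := by
  have hα := pos_of_dimH_lt hαD
  have hK := nonneg_of_mem_regMeasures hν
  have hdim : dimH D < (α.toNNReal : ENNReal) := by
    rw [← EReal.coe_ennreal_lt_coe_ennreal_iff]
    have : ((α.toNNReal : ENNReal) : EReal) = (α : EReal) := by
      rw [← ENNReal.ofReal, EReal.coe_ennreal_ofReal, max_eq_left hα.le]
    rwa [this]
  have hH := hausdorffMeasure_of_dimH_lt hdim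
  rw [Real.coe_toNNReal _ hα.le] at hH
  have hc0 : ENNReal.ofReal (K + 1) ≠ 0 := by simp; linarith
  have hle : (ENNReal.ofReal (K + 1))⁻¹ • (ν : Measure X) ≤ Measure.hausdorffMeasure α := by
    refine Measure.le_hausdorffMeasure α _ 1 one_pos fun s hs => ?_
    rw [Measure.smul_apply, smul_eq_mul, ← ENNReal.div_eq_inv_mul,
      ENNReal.div_le_iff hc0 ENNReal.ofReal_ne_top]
    rcases s.eq_empty_or_nonempty with rfl | ⟨x, hx⟩
    · simp
    have hfin : Metric.ediam s ≠ ⊤ := (hs.trans_lt ENNReal.one_lt_top).ne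
    have hreal : (ν : Measure X).real s ≤ K * Metric.diam s ^ α := by
      -- `s` lies in every ball about `x` of radius greater than its diameter, so the bound follows
      -- by letting `r` decrease to the diameter, which may be 0.
      have hlim : Tendsto (fun r : ℝ => K * r ^ α) (𝓝[>] Metric.diam s)
          (𝓝 (K * Metric.diam s ^ α)) :=
        ((Real.continuousAt_rpow_const _ _ (Or.inr hα.le)).tendsto.mono_left
          nhdsWithin_le_nhds).const_mul K
      refine ge_of_tendsto hlim ?_
      filter_upwards [self_mem_nhdsWithin] with r hr
      refine (measureReal_mono fun y hy => ?_).trans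
        (measureReal_ball_le hν x (Metric.diam_nonneg.trans_lt hr))
      exact (Metric.dist_le_diam_of_mem' hfin hy hx).trans_lt hr
    have h1 : (ν : Measure X) s ≤ ENNReal.ofReal (K * Metric.diam s ^ α) :=
      (ENNReal.le_ofReal_iff_toReal_le (measure_ne_top _ _)
        (mul_nonneg hK (Real.rpow_nonneg Metric.diam_nonneg _))).2 hreal
    have h2 : Metric.ediam s ^ α = ENNReal.ofReal (Metric.diam s ^ α) := by
      rw [← ENNReal.ofReal_rpow_of_nonneg Metric.diam_nonneg hα.le, Metric.diam,
        ENNReal.ofReal_toReal hfin]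
    rw [h2, mul_comm, ← ENNReal.ofReal_mul (by linarith)]
    refine h1.trans (ENNReal.ofReal_le_ofReal ?_)
    gcongr
    linarith
  have h := hle D
  rw [hH, Measure.smul_apply, smul_eq_mul, nonpos_iff_eq_zero, mul_eq_zero,
    ENNReal.inv_eq_zero] at h
  exact h.resolve_left ENNReal.ofReal_ne_top

end Regularity

/-! ### Upper semi-computability of the bound `K r^α`. -/

section RationalPowers

theorem exists_nat_div_btwn {x y : ℝ} (hx : 0 ≤ x) (hxy : x < y) :
    ∃ a b : ℕ, x < (a : ℝ) / (b + 1) ∧ (a : ℝ) / (b + 1) < y := by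
  obtain ⟨q, h1, h2⟩ := exists_rat_btwn hxy
  have hq : (0 : ℚ) < q := by exact_mod_cast hx.trans_lt h1
  have hcast : ((q.num.toNat : ℝ) / ((q.den - 1 : ℕ) + 1)) = q := by
    have hd : ((q.den - 1 : ℕ) : ℝ) + 1 = q.den := by
      exact_mod_cast Nat.sub_add_cancel q.den_pos
    have hn : (q.num.toNat : ℝ) = (q.num : ℝ) := by
      exact_mod_cast Int.toNat_of_nonneg (Rat.num_nonneg.2 hq.le)
    rw [hd, hn]
    exact_mod_cast q.num_div_den
  exact ⟨_, _, hcast ▸ h1, hcast ▸ h2⟩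

variable {α K : ℝ}

theorem rePred_lt_nat_div (hα : IsComputableReal α) :
    REPred fun p : ℕ × ℕ => α < (p.1 : ℝ) / (p.2 + 1) := by
  have h : Computable fun p : ℕ × ℕ => Nat.pair (Nat.pair p.1 0) p.2 :=
    (Primrec₂.natPair.comp (Primrec₂.natPair.comp Primrec.fst (Primrec.const 0))
      Primrec.snd).to_comp
  exact (hα.2.comp h).of_eq fun p => by simp [ratOfNat]

theorem rePred_nat_div_lt (hα : IsComputableReal α) :
    REPred fun p : ℕ × ℕ => (p.1 : ℝ) / (p.2 + 1) < α := by
  have h : Computable fun p : ℕ × ℕ => Nat.pair (Nat.pair p.1 0) p.2 :=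
    (Primrec₂.natPair.comp (Primrec₂.natPair.comp Primrec.fst (Primrec.const 0))
      Primrec.snd).to_comp
  exact (hα.1.comp h).of_eq fun p => by simp [ratOfNat]

/-- Raising both sides to the power `d + 1` clears the fractional exponent, leaving a decidable
inequality of integers. -/
theorem nat_div_mul_rpow_lt_iff (s t p q a b c d : ℕ) :
    (a : ℝ) / (b + 1) * (((s : ℝ) + 1) / (t + 1)) ^ ((c : ℝ) / (d + 1)) < (p : ℝ) / (q + 1) ↔
      a ^ (d + 1) * (s + 1) ^ c * (q + 1) ^ (d + 1)
        < p ^ (d + 1) * ((b + 1) ^ (d + 1) * (t + 1) ^ c) := by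
  have hr : (0 : ℝ) ≤ ((s : ℝ) + 1) / (t + 1) := by positivity
  have hpow : ((((s : ℝ) + 1) / (t + 1)) ^ ((c : ℝ) / (d + 1))) ^ (d + 1)
      = (((s : ℝ) + 1) / (t + 1)) ^ c := by
    rw [← Real.rpow_natCast, ← Real.rpow_mul hr, ← Real.rpow_natCast]
    congr 1
    push_cast
    field_simp
  rw [← pow_lt_pow_iff_left₀ (by positivity) (by positivity) (Nat.succ_ne_zero d), mul_pow, hpow,
    div_pow, div_pow, div_pow, div_mul_div_comm, div_lt_div_iff₀ (by positivity) (by positivity)]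
  norm_cast

/-- Replace `K` by a rational above it, and `α` by a rational on the side that increases the power:
above `α` if `r ≥ 1`, below if `r ≤ 1`. By continuity such rationals exist whenever the strict
inequality holds. -/
theorem rePred_mul_rpow_lt (hα : IsComputableReal α) (hK : IsComputableReal K) (hα0 : 0 < α)
    (hK0 : 0 ≤ K) : REPred fun p : ℕ × (ℕ × ℕ) =>
      K * ballRadius p.1 ^ α < (p.2.1 : ℝ) / (p.2.2 + 1) := by
  let τ := (ℕ × (ℕ × ℕ)) × ((ℕ × ℕ) × (ℕ × ℕ))
  have hst : Primrec fun w : τ => w.1.1.unpair.2.unpair :=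
    Primrec.unpair.comp (Primrec.snd.comp (Primrec.unpair.comp (Primrec.fst.comp Primrec.fst)))
  have hs : Primrec fun w : τ => w.1.1.unpair.2.unpair.1 := Primrec.fst.comp hst
  have ht : Primrec fun w : τ => w.1.1.unpair.2.unpair.2 := Primrec.snd.comp hst
  have hp : Primrec fun w : τ => w.1.2.1 := Primrec.fst.comp (Primrec.snd.comp Primrec.fst)
  have hq : Primrec fun w : τ => w.1.2.2 := Primrec.snd.comp (Primrec.snd.comp Primrec.fst)
  have hab : Primrec fun w : τ => w.2.1 := Primrec.fst.comp Primrec.snd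
  have hcd : Primrec fun w : τ => w.2.2 := Primrec.snd.comp Primrec.snd
  have ha : Primrec fun w : τ => w.2.1.1 := Primrec.fst.comp hab
  have hb : Primrec fun w : τ => w.2.1.2 := Primrec.snd.comp hab
  have hc : Primrec fun w : τ => w.2.2.1 := Primrec.fst.comp hcd
  have hd : Primrec fun w : τ => w.2.2.2 := Primrec.snd.comp hcd
  have hpow : ∀ {f g : τ → ℕ}, Computable f → Computable g → Computable fun w => f w ^ g w :=
    fun hf hg => Computable.nat_pow.comp hf hg
  have hmul : ∀ {f g : τ → ℕ}, Computable f → Computable g → Computable fun w => f w * g w :=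
    fun hf hg => Primrec.nat_mul.to_comp.comp hf hg
  have hsucc : ∀ {f : τ → ℕ}, Primrec f → Computable fun w => f w + 1 :=
    fun hf => (Primrec.succ.comp hf).to_comp
  have hle : ∀ {f g : τ → ℕ}, Primrec f → Primrec g → REPred fun w => f w ≤ g w := by
    intro f g hf hg
    have h : Computable fun w => decide (f w ≤ g w) := (Primrec.nat_le.decide.comp hf hg).to_comp
    exact (REPred.of_bool h).of_eq fun w => by simp
  have hlt : REPred fun w : τ => w.2.1.1 ^ (w.2.2.2 + 1) * (w.1.1.unpair.2.unpair.1 + 1) ^ w.2.2.1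
      * (w.1.2.2 + 1) ^ (w.2.2.2 + 1) < w.1.2.1 ^ (w.2.2.2 + 1) * ((w.2.1.2 + 1) ^ (w.2.2.2 + 1)
        * (w.1.1.unpair.2.unpair.2 + 1) ^ w.2.2.1) := by
    have h1 := hmul (hmul (hpow ha.to_comp (hsucc hd)) (hpow (hsucc hs) hc.to_comp))
      (hpow (hsucc hq) (hsucc hd))
    have h2 := hmul (hpow hp.to_comp (hsucc hd))
      (hmul (hpow (hsucc hb) (hsucc hd)) (hpow (hsucc ht) hc.to_comp))
    exact (REPred.of_bool (Primrec.nat_lt.decide.to_comp.comp h1 h2)).of_eq fun w => by simp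
  have hmain := ((((rePred_lt_nat_div hK).comp hab.to_comp).and
    (((hle ht hs).and ((rePred_lt_nat_div hα).comp hcd.to_comp)).or
      ((hle hs ht).and ((rePred_nat_div_lt hα).comp hcd.to_comp)))).and hlt).exists_snd
  refine hmain.of_eq fun p => ?_
  obtain ⟨n, p, q⟩ := p
  simp only [← nat_div_mul_rpow_lt_iff, ballRadius_eq]
  generalize n.unpair.2.unpair.1 = s
  generalize n.unpair.2.unpair.2 = t
  have hr : (0 : ℝ) < ((s : ℝ) + 1) / (t + 1) := by positivity
  constructor
  · rintro ⟨⟨⟨a, b⟩, c, d⟩, ⟨h1, h2⟩, h3⟩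
    refine lt_of_le_of_lt ?_ h3
    refine mul_le_mul h1.le ?_ (Real.rpow_nonneg hr.le _) (by positivity)
    rcases h2 with ⟨h4, h5⟩ | ⟨h4, h5⟩
    · refine Real.rpow_le_rpow_of_exponent_le ?_ h5.le
      rw [one_le_div (by positivity)]
      exact_mod_cast Nat.succ_le_succ h4
    · refine Real.rpow_le_rpow_of_exponent_ge hr ?_ h5.le
      rw [div_le_one (by positivity)]
      exact_mod_cast Nat.succ_le_succ h4
  · intro h
    have hcont : ∀ᶠ β in 𝓝 α, K * (((s : ℝ) + 1) / (t + 1)) ^ β < (p : ℝ) / (q + 1) :=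
      (continuous_const.mul (Real.continuous_const_rpow hr.ne')).continuousAt.eventually_lt
        continuousAt_const h
    obtain ⟨ε, hε, hball⟩ := Metric.eventually_nhds_iff.1 hcont
    have hβ : ∃ c d : ℕ, ((t ≤ s ∧ α < (c : ℝ) / (d + 1)) ∨ (s ≤ t ∧ (c : ℝ) / (d + 1) < α)) ∧
        dist ((c : ℝ) / (d + 1)) α < ε := by
      rcases le_total t s with hts | hst
      · obtain ⟨c, d, h1, h2⟩ := exists_nat_div_btwn hα0.le (show α < α + ε by linarith)
        refine ⟨c, d, Or.inl ⟨hts, h1⟩, ?_⟩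
        rw [Real.dist_eq, abs_lt]; constructor <;> linarith
      -- The maximum with 0 keeps the exponent a quotient of natural numbers; this uses `α > 0`.
      · obtain ⟨c, d, h1, h2⟩ := exists_nat_div_btwn (le_max_left 0 (α - ε))
          (max_lt hα0 (show α - ε < α by linarith))
        refine ⟨c, d, Or.inr ⟨hst, h2⟩, ?_⟩
        have := (le_max_right 0 (α - ε)).trans_lt h1
        rw [Real.dist_eq, abs_lt]; constructor <;> linarith
    obtain ⟨c, d, hcd, hdist⟩ := hβ
    have h4 := hball hdist
    have hrp := Real.rpow_pos_of_pos hr ((c : ℝ) / (d + 1))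
    rw [← lt_div_iff₀ hrp] at h4
    obtain ⟨a, b, h5, h6⟩ := exists_nat_div_btwn hK0 h4
    rw [lt_div_iff₀ hrp] at h6
    exact ⟨((a, b), (c, d)), ⟨h5, hcd⟩, h6⟩

end RationalPowers

/-! ### Regularity and invariance as recursively enumerable systems of tests. -/

/-- The number of the ideal ball with the same centre and twice the radius. -/
def doubleBall (n : ℕ) : ℕ :=
  Nat.pair n.unpair.1 (Nat.pair (2 * n.unpair.2.unpair.1 + 1) n.unpair.2.unpair.2)

theorem ballRadius_doubleBall (n : ℕ) : ballRadius (doubleBall n) = 2 * ballRadius n := by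
  simp only [ballRadius_eq, doubleBall, Nat.unpair_pair]
  push_cast
  ring

theorem primrec_doubleBall : Primrec doubleBall := by
  have h : Primrec fun n : ℕ => n.unpair.2.unpair :=
    Primrec.unpair.comp (Primrec.snd.comp Primrec.unpair)
  exact Primrec₂.natPair.comp (Primrec.fst.comp Primrec.unpair) (Primrec₂.natPair.comp
    (Primrec.succ.comp (Primrec.nat_mul.comp (Primrec.const 2) (Primrec.fst.comp h)))
    (Primrec.snd.comp h))

/-- Tests expressing `ν(B) ≤ K * r ^ α` for ideal balls `B` of radius `r`; here `one` is the name of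
the constant function `1`. -/
def RegularityTest (α K : ℝ) (one : List ℕ × ℕ) (t : List (List ℕ × ℕ) × List (List ℕ × ℕ)) :
    Prop :=
  ∃ w : (ℕ × (List ℕ × ℕ)) × (ℕ × ℕ), (K * ballRadius w.1.1 ^ α < (w.2.1 : ℝ) / (w.2.2 + 1) ∧
    ∀ m ∈ w.1.2.1, m = w.1.1) ∧ t = (List.replicate (w.2.2 + 1) w.1.2, List.replicate w.2.1 one)

/-- Tests expressing `ν(⋃ n ∈ M, U n) ≤ ν(⋃ n ∈ M, B n)` for finite lists `M`, where `U n` is the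
union of the ideal balls with numbers in the `n`-th section of `E`. -/
def InvarianceTest (E : ℕ × ℕ → Prop) (t : List (List ℕ × ℕ) × List (List ℕ × ℕ)) : Prop :=
  ∃ w : (List ℕ × ℕ) × (List ℕ × ℕ), ((∀ i ∈ w.1.1, ∃ n, n ∈ w.2.1 ∧ E (n, i)) ∧
    ∀ n ∈ w.2.1, n.unpair.2.unpair.2 < w.2.2) ∧ t = ([w.1], [(w.2.1.map doubleBall, w.2.2)])

theorem rePred_regularityTest {α K : ℝ} (hα : IsComputableReal α) (hK : IsComputableReal K)
    (hα0 : 0 < α) (hK0 : 0 ≤ K) (one : List ℕ × ℕ) : REPred (RegularityTest α K one) := by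
  let τ := (List (List ℕ × ℕ) × List (List ℕ × ℕ)) × ((ℕ × (List ℕ × ℕ)) × (ℕ × ℕ))
  have hn : Computable fun w : τ => w.2.1.1 :=
    Computable.fst.comp (Computable.fst.comp Computable.snd)
  have hu : Computable fun w : τ => w.2.1.2 :=
    Computable.snd.comp (Computable.fst.comp Computable.snd)
  have hp : Computable fun w : τ => w.2.2.1 :=
    Computable.fst.comp (Computable.snd.comp Computable.snd)
  have hq : Computable fun w : τ => w.2.2.2 :=
    Computable.snd.comp (Computable.snd.comp Computable.snd)
  have h0 : Computable fun w : τ => (w.2.1.1, w.2.2) :=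
    hn.pair (Computable.snd.comp Computable.snd)
  have h1 := (rePred_mul_rpow_lt hα hK hα0 hK0).comp h0
  have h2 : REPred fun w : τ => ∀ m ∈ w.2.1.2.1, m = w.2.1.1 :=
    REPred.forall_mem (p := fun x : ℕ × τ => x.1 = x.2.2.1.1)
      (REPred.eq_of_computable Computable.fst (hn.comp Computable.snd)) (Computable.fst.comp hu)
  have h3 : Computable fun w : τ => List.replicate (w.2.2.2 + 1) w.2.1.2 :=
    Computable.list_replicate.comp (Computable.succ.comp hq) hu
  have h4 : Computable fun w : τ => List.replicate w.2.2.1 one :=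
    Computable.list_replicate.comp hp (Computable.const one)
  exact ((h1.and h2).and (REPred.eq_of_computable Computable.fst (h3.pair h4))).exists_snd

theorem rePred_invarianceTest {E : ℕ × ℕ → Prop} (hE : REPred E) : REPred (InvarianceTest E) := by
  let τ := (List (List ℕ × ℕ) × List (List ℕ × ℕ)) × ((List ℕ × ℕ) × (List ℕ × ℕ))
  have hu : Computable fun w : τ => w.2.1 := Computable.fst.comp Computable.snd
  have hM : Computable fun w : τ => w.2.2.1 :=
    Computable.fst.comp (Computable.snd.comp Computable.snd)
  have hk : Computable fun w : τ => w.2.2.2 :=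
    Computable.snd.comp (Computable.snd.comp Computable.snd)
  have h0 : Computable fun x : (ℕ × τ) × ℕ => (x.2, x.1.1) :=
    Computable.snd.pair (Computable.fst.comp Computable.fst)
  have h1 : REPred fun x : (ℕ × τ) × ℕ => x.2 ∈ x.1.2.2.2.1 ∧ E (x.2, x.1.1) :=
    (REPred.mem_list (hM.comp (Computable.snd.comp Computable.fst)) Computable.snd).and
      (hE.comp h0 :)
  have h2 : REPred fun w : τ => ∀ i ∈ w.2.1.1, ∃ n, n ∈ w.2.2.1 ∧ E (n, i) :=
    REPred.forall_mem (p := fun x : ℕ × τ => ∃ n, n ∈ x.2.2.2.1 ∧ E (n, x.1))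
      h1.exists_snd (Computable.fst.comp hu)
  have h3 : Computable fun x : ℕ × τ => x.1.unpair.2.unpair.2 :=
    Computable.snd.comp (Computable.unpair.comp
      (Computable.snd.comp (Computable.unpair.comp Computable.fst)))
  have h4 : REPred fun x : ℕ × τ => x.1.unpair.2.unpair.2 < x.2.2.2.2 :=
    (REPred.of_bool (Primrec.nat_lt.decide.to_comp.comp h3 (hk.comp Computable.snd))).of_eq
      fun x => by simp
  have h5 : REPred fun w : τ => ∀ n ∈ w.2.2.1, n.unpair.2.unpair.2 < w.2.2.2 :=
    REPred.forall_mem h4 hM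
  have hdbl : Primrec fun M : List ℕ => M.map doubleBall :=
    Primrec.list_map Primrec.id (primrec_doubleBall.comp Primrec.snd)
  have h6 : Computable fun w : τ => [w.2.1] :=
    Computable.list_cons.comp hu (Computable.const [])
  have h7 : Computable fun w : τ => [(w.2.2.1.map doubleBall, w.2.2.2)] :=
    Computable.list_cons.comp ((hdbl.to_comp.comp hM).pair hk) (Computable.const [])
  exact ((h2.and h5).and (REPred.eq_of_computable Computable.fst (h6.pair h7))).exists_snd

namespace ComputableMetricStructure

variable {X : Type*} [MetricSpace X] (S : ComputableMetricStructure X)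

theorem exists_bump_eq_one [CompactSpace X] [Nonempty X] :
    ∃ one : List ℕ × ℕ, ∀ x, S.bump one x = 1 := by
  obtain ⟨b, hb⟩ := exists_nat_ge (Metric.diam (univ : Set X))
  refine ⟨([Nat.pair 0 (Nat.pair b 0)], 1), fun x =>
    S.bump_eq_one (n := Nat.pair 0 (Nat.pair b 0)) (by simp) ?_⟩
  have h := Metric.dist_le_diam_of_mem (isCompact_univ (X := X)).isBounded
    (mem_univ (S.pt 0)) (mem_univ x)
  simp only [ballRadius_eq, Nat.unpair_pair, Nat.cast_one, one_mul, Nat.cast_zero, zero_add,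
    div_one]
  linarith

theorem isOpen_eq_iUnion_idealBall {G : Set X} (hG : IsOpen G) :
    G = ⋃ (n : ℕ) (_ : S.idealBall n ⊆ G), S.idealBall n := by
  refine Subset.antisymm (fun x hx => ?_) (iUnion₂_subset fun n hn => hn)
  obtain ⟨n, hn, hsub⟩ := S.exists_mem_idealBall_subset hG hx
  refine mem_iUnion₂.2 ⟨n, (Metric.ball_subset_ball ?_).trans hsub, hn⟩
  have := ballRadius_pos n
  change ballRadius n ≤ _
  linarith

theorem isOpen_biUnion_list (M : List ℕ) : IsOpen (⋃ n ∈ M, S.idealBall n) :=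
  isOpen_biUnion fun n _ => S.isOpen_idealBall n

theorem integral_one [MeasurableSpace X] {one : List ℕ × ℕ} (hone : ∀ x, S.bump one x = 1) (ν : ProbabilityMeasure X) :
    ∫ x, S.bump one x ∂(ν : Measure X) = 1 := by
  simp [hone]

/-- Repetition encodes rational coefficients, so tests can compare an integral with a rational
number. -/
theorem satisfiesTest_replicate_left [MeasurableSpace X] {one : List ℕ × ℕ} (hone : ∀ x, S.bump one x = 1)
    (ν : ProbabilityMeasure X) (p q : ℕ) (u : List ℕ × ℕ) :
    S.SatisfiesTest ν (List.replicate (q + 1) u, List.replicate p one) ↔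
      ∫ x, S.bump u x ∂(ν : Measure X) ≤ (p : ℝ) / (q + 1) := by
  simp only [SatisfiesTest, bumpSum_replicate, integral_const_mul, S.integral_one hone, mul_one]
  rw [le_div_iff₀ (by positivity), mul_comm]
  push_cast
  rfl

theorem satisfiesTest_replicate_right [MeasurableSpace X] {one : List ℕ × ℕ} (hone : ∀ x, S.bump one x = 1)
    (ν : ProbabilityMeasure X) (p q : ℕ) (u : List ℕ × ℕ) :
    S.SatisfiesTest ν (List.replicate p one, List.replicate (q + 1) u) ↔
      (p : ℝ) / (q + 1) ≤ ∫ x, S.bump u x ∂(ν : Measure X) := by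
  simp only [SatisfiesTest, bumpSum_replicate, integral_const_mul, S.integral_one hone, mul_one]
  rw [div_le_iff₀ (by positivity), mul_comm]
  push_cast
  rfl

/-- Here the nullness of `D` enters: off `D` the two sets coincide. -/
theorem measureReal_preimage_eq [MeasurableSpace X] {T : X → X} {D : Set X}
    {E : ℕ × ℕ → Prop} {ν : ProbabilityMeasure X} (hνD : (ν : Measure X) D = 0)
    (hE : ∀ n, T ⁻¹' (S.idealBall n) ∩ Dᶜ = (⋃ (i : ℕ) (_ : E (n, i)), S.idealBall i) ∩ Dᶜ)
    (M : List ℕ) :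
    (ν : Measure X).real (⋃ (i : ℕ) (_ : ∃ n, n ∈ M ∧ E (n, i)), S.idealBall i)
      = (ν : Measure X).real (T ⁻¹' (⋃ n ∈ M, S.idealBall n)) := by
  refine measureReal_congr ?_
  filter_upwards [measure_eq_zero_iff_ae_notMem.1 hνD] with x hx
  have h : ∀ n, T x ∈ S.idealBall n ↔ ∃ i, E (n, i) ∧ x ∈ S.idealBall i := by
    intro n
    have := Set.ext_iff.1 (hE n) x
    simpa [hx] using this
  refine propext ?_
  change x ∈ (⋃ (i : ℕ) (_ : ∃ n, n ∈ M ∧ E (n, i)), S.idealBall i) ↔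
    x ∈ T ⁻¹' (⋃ n ∈ M, S.idealBall n)
  simp only [mem_iUnion, mem_preimage, h, exists_prop]
  constructor
  · rintro ⟨i, ⟨n, hn, hE⟩, hx⟩; exact ⟨n, hn, i, hE, hx⟩
  · rintro ⟨n, hn, i, hE, hx⟩; exact ⟨i, ⟨n, hn, hE⟩, hx⟩

variable [CompactSpace X] [MeasurableSpace X] [BorelSpace X] {α K : ℝ} {one : List ℕ × ℕ}

theorem satisfiesTest_of_regularityTest (hone : ∀ x, S.bump one x = 1) {ν : ProbabilityMeasure X}
    (hν : ν ∈ regMeasures X α K) {t : List (List ℕ × ℕ) × List (List ℕ × ℕ)}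
    (ht : RegularityTest α K one t) : S.SatisfiesTest ν t := by
  obtain ⟨⟨⟨n, u⟩, p, q⟩, ⟨h1, h2⟩, rfl⟩ := ht
  rw [S.satisfiesTest_replicate_left hone]
  refine le_trans ?_ h1.le
  refine (S.integral_bump_le u ν (G := S.idealBall n) (fun m hm => by rw [h2 m hm])
    (S.isOpen_idealBall n).measurableSet).trans ?_
  exact measureReal_ball_le hν _ (ballRadius_pos n)

theorem mem_regMeasures_of_satisfiesTest (hone : ∀ x, S.bump one x = 1) (hα0 : 0 < α)
    (hK0 : 0 ≤ K) {ν : ProbabilityMeasure X}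
    (h : ∀ t, RegularityTest α K one t → S.SatisfiesTest ν t) : ν ∈ regMeasures X α K := by
  have hideal : ∀ n, (ν : Measure X).real (S.idealBall n) ≤ K * ballRadius n ^ α := by
    intro n
    by_contra! hlt
    obtain ⟨p, q, h1, h2⟩ := exists_nat_div_btwn
      (mul_nonneg hK0 (Real.rpow_nonneg (ballRadius_pos n).le α)) hlt
    have hU : S.idealBall n = ⋃ (m : ℕ) (_ : m = n), S.idealBall m := by simp
    rw [hU] at h2
    obtain ⟨u, hu, hlt⟩ := S.exists_lt_integral_bump ν (fun m => m = n) h2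
    have := (S.satisfiesTest_replicate_left hone ν p q u).1
      (h _ ⟨((n, u), (p, q)), ⟨h1, hu⟩, rfl⟩)
    linarith
  refine mem_regMeasures_of_forall hK0 fun x r hr => ?_
  by_contra! hlt
  -- From ideal balls to all balls: a violation at `B(x, r)` persists for a slightly larger rational
  -- radius, which leaves room to move the centre to an ideal point.
  have hcont : ∀ᶠ s in 𝓝[>] r, K * s ^ α < (ν : Measure X).real (Metric.ball x r) :=
    nhdsWithin_le_nhds ((continuousAt_const.mul (Real.continuousAt_rpow_const r α
      (Or.inr hα0.le))).eventually_lt continuousAt_const hlt)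
  obtain ⟨r', hr', hsub⟩ := (mem_nhdsGT_iff_exists_Ioo_subset).1 hcont
  obtain ⟨a, b, h1, h2⟩ := exists_nat_div_btwn hr.le hr'
  have ha : a ≠ 0 := by
    rintro rfl
    simp at h1
    linarith
  obtain ⟨c, rfl⟩ := Nat.exists_eq_succ_of_ne_zero ha
  obtain ⟨i, hi⟩ := S.dense.exists_dist_lt x (sub_pos.2 h1)
  have hrad : ballRadius (Nat.pair i (Nat.pair c b)) = ((c.succ : ℕ) : ℝ) / (b + 1) := by
    simp [ballRadius_eq]
  have h3 := hideal (Nat.pair i (Nat.pair c b))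
  rw [hrad] at h3
  have h4 : K * (((c.succ : ℕ) : ℝ) / (b + 1)) ^ α < (ν : Measure X).real (Metric.ball x r) :=
    hsub ⟨h1, h2⟩
  refine (h3.trans_lt h4).not_ge (measureReal_mono fun y hy => ?_)
  rw [mem_idealBall, hrad, Nat.unpair_pair]
  have := dist_triangle (S.pt i) x y
  rw [Metric.mem_ball'] at hy
  rw [dist_comm x] at hi
  simp only
  linarith

section Invariance

variable {T : X → X} {D : Set X} {E : ℕ × ℕ → Prop} {ν : ProbabilityMeasure X}

/-- The chain is `∫ u ≤ ν(⋃ U_n) = ν(T⁻¹ ⋃ B_n) = ν(⋃ B_n)`, and the bump over the doubled balls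
equals 1 on `⋃ B_n`. -/
theorem satisfiesTest_of_invarianceTest (hT : MeasurePreserving T (ν : Measure X) ν)
    (hνD : (ν : Measure X) D = 0)
    (hE : ∀ n, T ⁻¹' (S.idealBall n) ∩ Dᶜ = (⋃ (i : ℕ) (_ : E (n, i)), S.idealBall i) ∩ Dᶜ)
    {t : List (List ℕ × ℕ) × List (List ℕ × ℕ)} (ht : InvarianceTest E t) :
    S.SatisfiesTest ν t := by
  obtain ⟨⟨u, M, k⟩, ⟨h1, h2⟩, rfl⟩ := ht
  simp only [SatisfiesTest, bumpSum_singleton]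
  have hU : IsOpen (⋃ (i : ℕ) (_ : ∃ n, n ∈ M ∧ E (n, i)), S.idealBall i) :=
    isOpen_iUnion fun i => isOpen_iUnion fun _ => S.isOpen_idealBall i
  refine (S.integral_bump_le u ν (fun i hi => ?_) hU.measurableSet).trans ?_
  · exact subset_iUnion₂_of_subset i (h1 i hi) Subset.rfl
  rw [S.measureReal_preimage_eq hνD hE,
    hT.measureReal_preimage (S.isOpen_biUnion_list M).measurableSet.nullMeasurableSet]
  refine S.le_integral_bump _ ν (fun x hx => ?_) (S.isOpen_biUnion_list M).measurableSet
  obtain ⟨n, hn, hx⟩ := mem_iUnion₂.1 hx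
  refine S.bump_eq_one (List.mem_map_of_mem hn) ?_
  rw [mem_idealBall] at hx
  have hk : (n.unpair.2.unpair.2 : ℝ) + 1 ≤ k := by exact_mod_cast h2 n hn
  -- The radius is at least the reciprocal of its denominator, so a slope `k` above all denominators
  -- in `M` suffices.
  have hr : 1 ≤ (k : ℝ) * ballRadius n := by
    rw [ballRadius_eq, mul_div_assoc', le_div_iff₀ (by positivity), one_mul]
    refine hk.trans (le_mul_of_one_le_right (Nat.cast_nonneg k) ?_)
    simp
  rw [ballRadius_doubleBall, doubleBall, Nat.unpair_pair]
  refine hr.trans (mul_le_mul_of_nonneg_left ?_ (Nat.cast_nonneg k))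
  simp only
  linarith

/-- One-sided inequalities suffice: the image measure is at most `ν` on open sets, hence everywhere
by outer regularity, and two comparable probability measures are equal. -/
theorem measurePreserving_of_satisfiesTest (hT : Measurable T) (hνD : (ν : Measure X) D = 0)
    (hE : ∀ n, T ⁻¹' (S.idealBall n) ∩ Dᶜ = (⋃ (i : ℕ) (_ : E (n, i)), S.idealBall i) ∩ Dᶜ)
    (h : ∀ t, InvarianceTest E t → S.SatisfiesTest ν t) :
    MeasurePreserving T (ν : Measure X) ν := by
  have : IsProbabilityMeasure ((ν : Measure X).map T) :=
    Measure.isProbabilityMeasure_map hT.aemeasurable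
  have hopen : ∀ G : Set X, IsOpen G → (ν : Measure X).map T G ≤ (ν : Measure X) G := by
    intro G hG
    by_contra! hlt
    obtain ⟨F, hFG, hF, hlt⟩ := hG.exists_lt_isCompact hlt
    -- Since the doubled balls stay in `G`, the right side of the test for `M` is at most `ν(G)`,
    -- while its left side can be made larger than `ν(G)`.
    obtain ⟨M, hM, hcov⟩ := S.exists_list_cover hF
      (p := fun n => Metric.ball (S.pt n.unpair.1) (2 * ballRadius n) ⊆ G) fun x hx => by
        obtain ⟨n, hn, hsub⟩ := S.exists_mem_idealBall_subset hG (hFG hx)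
        exact ⟨n, hsub, hn⟩
    have h1 : (ν : Measure X).real G
        < (ν : Measure X).real (⋃ (i : ℕ) (_ : ∃ n, n ∈ M ∧ E (n, i)), S.idealBall i) := by
      rw [S.measureReal_preimage_eq hνD hE]
      refine ENNReal.toReal_strict_mono (measure_ne_top _ _) (hlt.trans_le ?_)
      rw [← Measure.map_apply hT (S.isOpen_biUnion_list M).measurableSet]
      exact measure_mono hcov
    obtain ⟨u, hu, hlt⟩ := S.exists_lt_integral_bump ν _ h1
    have hk : ∃ k, ∀ n ∈ M, n.unpair.2.unpair.2 < k := by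
      clear hM hcov h1 hu
      induction M with
      | nil => exact ⟨0, by simp⟩
      | cons n M ih =>
        obtain ⟨k, hk⟩ := ih
        refine ⟨max k (n.unpair.2.unpair.2 + 1), fun m hm => ?_⟩
        rcases List.mem_cons.1 hm with rfl | hm
        · exact lt_max_of_lt_right (Nat.lt_succ_self _)
        · exact lt_max_of_lt_left (hk m hm)
    obtain ⟨k, hk⟩ := hk
    have h2 := h _ ⟨(u, (M, k)), ⟨hu, hk⟩, rfl⟩
    simp only [SatisfiesTest, bumpSum_singleton] at h2
    refine (hlt.trans_le h2).not_ge (S.integral_bump_le _ ν (fun m hm => ?_) hG.measurableSet)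
    obtain ⟨n, hn, rfl⟩ := List.mem_map.1 hm
    refine Subset.trans (fun x hx => ?_) (hM n hn)
    rw [mem_idealBall, ballRadius_doubleBall, doubleBall, Nat.unpair_pair] at hx
    exact Metric.mem_ball'.2 hx
  have hle : (ν : Measure X).map T ≤ ν := Measure.le_iff.2 fun s _ => by
    rw [s.measure_eq_iInf_isOpen (ν : Measure X)]
    exact le_iInf₂ fun U hU => le_iInf fun hUo => (measure_mono hU).trans (hopen U hUo)
  exact ⟨hT, Measure.eq_of_le_of_isProbabilityMeasure hle⟩

end Invariance

/-! ### Isolation turned into a uniquely solvable system. -/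

/-- Every weak neighbourhood of `μ` contains one that is cut out by finitely many tests. -/
theorem exists_list_tests_subset (hone : ∀ x, S.bump one x = 1) {μ : ProbabilityMeasure X}
    {O : Set (ProbabilityMeasure X)} (hO : IsOpen O) (hμ : μ ∈ O) :
    ∃ L : List (List (List ℕ × ℕ) × List (List ℕ × ℕ)), (∀ t ∈ L, S.SatisfiesTest μ t) ∧
      ∀ ν : ProbabilityMeasure X, (∀ t ∈ L, S.SatisfiesTest ν t) → ν ∈ O := by
  classical
  by_contra! hcon
  let 𝕋 := List (List ℕ × ℕ) × List (List ℕ × ℕ)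
  -- The tests true at `μ` with code below `n`. If none of these lists works, the counterexamples `ν
  -- n` eventually satisfy each true test, hence converge to `μ` by the portmanteau criterion on
  -- open sets.
  let L : ℕ → List 𝕋 := fun n =>
    ((List.range n).filterMap fun m => Encodable.decode (α := 𝕋) m).filter
      fun t => S.SatisfiesTest μ t
  have hL : ∀ n, ∀ t ∈ L n, S.SatisfiesTest μ t := fun n t ht => by
    simpa using (List.mem_filter.1 ht).2
  choose ν hν hνO using fun n => hcon (L n) (hL n)
  have hev : ∀ t, S.SatisfiesTest μ t → ∀ᶠ n in atTop, S.SatisfiesTest (ν n) t := by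
    intro t ht
    filter_upwards [eventually_gt_atTop (Encodable.encode t)] with n hn
    refine hν n t (List.mem_filter.2 ⟨List.mem_filterMap.2
      ⟨Encodable.encode t, List.mem_range.2 hn, Encodable.encodek t⟩, by simpa using ht⟩)
  have hlim : Tendsto ν atTop (𝓝 μ) := by
    refine tendsto_of_forall_isOpen_le_liminf fun G hG => ?_
    refine (le_liminf_iff (isCoboundedUnder_ge_of_le (x := 1) atTop (by simp))
      (by isBoundedDefault)).2 fun c hc => ?_
    have hc' : (c : ℝ) < (μ : Measure X).real G := by exact_mod_cast hc
    rw [S.isOpen_eq_iUnion_idealBall hG] at hc'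
    obtain ⟨u, hu, hlt⟩ := S.exists_lt_integral_bump μ _ hc'
    obtain ⟨p, q, h1, h2⟩ := exists_nat_div_btwn c.coe_nonneg hlt
    filter_upwards [hev _ ((S.satisfiesTest_replicate_right hone μ p q u).2 h2.le)] with n hn
    have h3 := (S.satisfiesTest_replicate_right hone (ν n) p q u).1 hn
    have h4 := S.integral_bump_le u (ν n) hu hG.measurableSet
    have h5 : (c : ℝ) < (ν n : Measure X).real G := by linarith
    exact_mod_cast h5
  obtain ⟨n, hn⟩ := (hlim.eventually (hO.mem_nhds hμ)).exists
  exact hνO n hn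

/-- Strict inequalities between integrals of bump sums are semi-decidable at a measure which is
isolated among the invariant measures of bounded regularity. -/
theorem rePred_integral_lt_of_isIsolatedInvariant (hX : S.RecursivelyCompact univ)
    {T : X → X} (hT : Measurable T) {D : Set X} (hTD : S.ComputableOn T Dᶜ)
    (hαD : (dimH D : EReal) < (α : EReal)) (hα : IsComputableReal α) (hK : IsComputableReal K)
    {μ : ProbabilityMeasure X} (hμ : IsIsolatedInvariant T (regMeasures X α K) μ) :
    REPred fun t : List (List ℕ × ℕ) × List (List ℕ × ℕ) =>
      ∫ x, S.bumpSum t.1 x ∂(μ : Measure X) < ∫ x, S.bumpSum t.2 x ∂(μ : Measure X) := by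
  obtain ⟨hμV, hμT, O, hO, hμO, huniq⟩ := hμ
  obtain ⟨U, ⟨E, hE, hUE⟩, hU⟩ := hTD
  have hEU : ∀ n, T ⁻¹' (S.idealBall n) ∩ Dᶜ
      = (⋃ (i : ℕ) (_ : E (n, i)), S.idealBall i) ∩ Dᶜ := fun n => by rw [hU, hUE]
  have hα0 := pos_of_dimH_lt hαD
  have hK0 := nonneg_of_mem_regMeasures hμV
  have : Nonempty X := μ.nonempty
  obtain ⟨one, hone⟩ := S.exists_bump_eq_one
  obtain ⟨L, hLμ, hLO⟩ := S.exists_list_tests_subset hone hO hμO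
  -- The list `L` is not found effectively, but as a fixed finite list it is decidable.
  refine S.rePred_integral_lt hX (((rePred_regularityTest hα hK hα0 hK0 one).or
    (rePred_invarianceTest hE)).or (REPred.mem_list (Computable.const L) Computable.id)) μ ?_ ?_
  · rintro t ((ht | ht) | ht)
    · exact S.satisfiesTest_of_regularityTest hone hμV ht
    · exact S.satisfiesTest_of_invarianceTest hμT (measure_eq_zero_of_dimH_lt hαD hμV) hEU ht
    · exact hLμ t ht
  · intro ν hν
    have hνV : ν ∈ regMeasures X α K := S.mem_regMeasures_of_satisfiesTest hone hα0 hK0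
      fun t ht => hν t (Or.inl (Or.inl ht))
    exact huniq ν (hLO ν fun t ht => hν t (Or.inr ht)) hνV
      (S.measurePreserving_of_satisfiesTest hT (measure_eq_zero_of_dimH_lt hαD hνV) hEU
        fun t ht => hν t (Or.inl (Or.inr ht)))

end ComputableMetricStructure

/-! ### Approximation of `μ` by ideal measures. -/

namespace ComputableMetricStructure

/-- The name of a bump function supported in the balls of radius `2 / (m + 1)` centred at the ideal
points of a list. -/
def coverBump (m : ℕ) (l : List (ℕ × ℕ)) : List ℕ × ℕ :=
  (l.map fun p => Nat.pair p.1 (Nat.pair 1 m), m + 1)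

theorem coverBump_cons_congr (m i w w' : ℕ) (l : List (ℕ × ℕ)) :
    coverBump m ((i, w) :: l) = coverBump m ((i, w') :: l) := rfl

theorem diracSumWeight_pos (c : (ℕ × ℕ) × List (ℕ × ℕ)) : 0 < diracSumWeight (c.1 :: c.2) := by
  simp [diracSumWeight]

theorem computable_diracSumWeight : Computable diracSumWeight :=
  Computable.list_map_sum Computable.id
    (Computable.succ.comp (Computable.snd.comp Computable.snd))

theorem primrec_coverBump : Primrec fun x : ℕ × List (ℕ × ℕ) => coverBump x.1 x.2 := by
  have h1 : Primrec₂ fun (x : ℕ × List (ℕ × ℕ)) (p : ℕ × ℕ) =>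
      Nat.pair p.1 (Nat.pair 1 x.1) :=
    Primrec₂.natPair.comp (Primrec.fst.comp Primrec.snd)
      (Primrec₂.natPair.comp (Primrec.const 1) (Primrec.fst.comp Primrec.fst))
  exact (Primrec.list_map Primrec.snd h1).pair (Primrec.succ.comp Primrec.fst)

variable {X : Type*} [MetricSpace X] (S : ComputableMetricStructure X)

@[simp]
theorem bump_coverBump_nil (m : ℕ) (x : X) : S.bump (coverBump m []) x = 0 :=
  S.bump_eq_zero (by simp [coverBump])

theorem bump_coverBump_mono (m : ℕ) (p : ℕ × ℕ) (l : List (ℕ × ℕ)) (x : X) :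
    S.bump (coverBump m l) x ≤ S.bump (coverBump m (p :: l)) x := by
  refine min_le_min_left 1 (mul_le_mul_of_nonneg_left ?_ (Nat.cast_nonneg _))
  simp only [coverBump, List.map_cons, List.sum_cons]
  exact le_add_of_nonneg_left (le_max_left _ _)

/-- Adding a point changes the bump only within `2 / (m + 1)` of it. The successive differences
along a covering list thus act as a partition of unity. -/
theorem bump_coverBump_cons_eq {m : ℕ} {p : ℕ × ℕ} (l : List (ℕ × ℕ)) {x : X}
    (h : 2 / ((m : ℝ) + 1) ≤ dist (S.pt p.1) x) :
    S.bump (coverBump m (p :: l)) x = S.bump (coverBump m l) x := by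
  have hr : ballRadius (Nat.pair p.1 (Nat.pair 1 m)) = 2 / ((m : ℝ) + 1) := by
    simp [ballRadius_eq]; norm_num
  have h0 : max 0 (2 / ((m : ℝ) + 1) - dist (S.pt p.1) x) = 0 := max_eq_left (by linarith)
  simp [bump, coverBump, hr, h0]

theorem bump_coverBump_eq_one {m : ℕ} {l : List (ℕ × ℕ)}
    (h : univ ⊆ ⋃ i ∈ l.map fun p => Nat.pair p.1 (Nat.pair 0 m), S.idealBall i) (x : X) :
    S.bump (coverBump m l) x = 1 := by
  obtain ⟨i, hi, hx⟩ := mem_iUnion₂.1 (h (mem_univ x))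
  obtain ⟨p, hp, rfl⟩ := List.mem_map.1 hi
  refine S.bump_eq_one (List.mem_map_of_mem hp) ?_
  rw [mem_idealBall, ballRadius_eq] at hx
  simp only [Nat.unpair_pair, Nat.cast_zero, zero_add] at hx
  simp only [coverBump, ballRadius_eq, Nat.unpair_pair]
  push_cast
  have hm : (0 : ℝ) < (m : ℝ) + 1 := by positivity
  rw [lt_div_iff₀ hm] at hx
  rw [mul_sub, mul_div_cancel₀ _ hm.ne']
  nlinarith

variable [MeasurableSpace X]

/-- The masses that `μ` gives to the successive differences of the functions `coverBump m l` exceed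
the weights of the list by little. -/
def MassBound (μ : ProbabilityMeasure X) (m N k : ℕ) (l : List (ℕ × ℕ)) : Prop :=
  ∀ j < l.length, (N * ((m + 1) * k) : ℕ) * ∫ x, S.bump (coverBump m (l.drop j)) x ∂(μ : Measure X)
    < (N * ((m + 1) * k) : ℕ) * ∫ x, S.bump (coverBump m (l.drop (j + 1))) x ∂(μ : Measure X)
      + (((l.drop j).headI.2 + 1) * ((m + 1) * k) + N : ℕ)

theorem isFiniteMeasure_diracSum (l : List (ℕ × ℕ)) : IsFiniteMeasure (S.diracSum l) :=
  ⟨by rw [diracSum_univ]; exact ENNReal.natCast_lt_top _⟩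

/-- Weights approximating `n` times the masses of the successive differences of the functions
`coverBump m l`. -/
noncomputable def weightedCover (μ : ProbabilityMeasure X) (m n : ℕ) : List ℕ → List (ℕ × ℕ)
  | [] => []
  | i :: t => (i, ⌊(n : ℝ) * (∫ x, S.bump (coverBump m ((i, 0) :: weightedCover μ m n t)) x
      ∂(μ : Measure X) - ∫ x, S.bump (coverBump m (weightedCover μ m n t)) x ∂(μ : Measure X))⌋₊)
      :: weightedCover μ m n t

theorem length_weightedCover (μ : ProbabilityMeasure X) (m n : ℕ) (l : List ℕ) :
    (S.weightedCover μ m n l).length = l.length := by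
  induction l with
  | nil => rfl
  | cons i t ih => simp [weightedCover, ih]

theorem map_fst_weightedCover (μ : ProbabilityMeasure X) (m n : ℕ) (l : List ℕ) :
    (S.weightedCover μ m n l).map Prod.fst = l := by
  induction l with
  | nil => rfl
  | cons i t ih => simp [weightedCover, ih]

theorem drop_weightedCover (μ : ProbabilityMeasure X) (m n : ℕ) (l : List ℕ) (j : ℕ) :
    (S.weightedCover μ m n l).drop j = S.weightedCover μ m n (l.drop j) := by
  induction l generalizing j with
  | nil => simp [weightedCover]
  | cons i t ih =>
    cases j with
    | zero => simp
    | succ j => simp [weightedCover, ih]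

variable [CompactSpace X] [BorelSpace X]

/-- Telescoping over the list: on the slice of `p`, `F` is at most `F (S.pt p.1) + 2 / (m + 1)`, and
the mass of the slice exceeds `(p.2 + 1) / N` by less than `1 / ((m + 1) k)`. Both `N` and `k` stay
fixed so that the induction can shorten the list. -/
theorem MassBound.integral_mul_le {S : ComputableMetricStructure X} {μ : ProbabilityMeasure X}
    {m N k : ℕ} (hN : 0 < N) (hk : 0 < k) {F : X → ℝ} (hF : LipschitzWith 1 F) {R : ℝ}
    (hF0 : ∀ x, 0 ≤ F x) (hFR : ∀ x, F x ≤ R) {l : List (ℕ × ℕ)} (h : S.MassBound μ m N k l) :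
    ∫ x, S.bump (coverBump m l) x * F x ∂(μ : Measure X)
      ≤ (l.map fun p => ((p.2 : ℝ) + 1) / N * F (S.pt p.1)).sum + l.length * (R / ((m + 1) * k))
        + 2 / (m + 1) * ∫ x, S.bump (coverBump m l) x ∂(μ : Measure X) := by
  induction l with
  | nil => simp
  | cons p t ih =>
    have ht : S.MassBound μ m N k t := fun j hj => by
      simpa using h (j + 1) (by simpa using hj)
    have h0 := h 0 (by simp)
    simp only [List.drop_zero, zero_add, List.drop_succ_cons, List.headI_cons] at h0
    push_cast at h0
    have hint : ∀ l, Integrable (fun x => S.bump (coverBump m l) x * F x) (μ : Measure X) :=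
      fun l => ((S.continuous_bump _).mul hF.continuous).integrable_of_hasCompactSupport
        (HasCompactSupport.of_compactSpace _)
    have hI := fun l => S.integrable_bump (coverBump m l) (μ : Measure X)
    have hpt : ∀ x, S.bump (coverBump m (p :: t)) x * F x ≤ S.bump (coverBump m t) x * F x
        + (S.bump (coverBump m (p :: t)) x - S.bump (coverBump m t) x)
          * (F (S.pt p.1) + 2 / (m + 1)) := by
      intro x
      rcases le_or_gt (2 / ((m : ℝ) + 1)) (dist (S.pt p.1) x) with hd | hd
      · rw [S.bump_coverBump_cons_eq t hd]; simp
      · have h1 := hF.dist_le_mul x (S.pt p.1)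
        rw [Real.dist_eq, NNReal.coe_one, one_mul, dist_comm] at h1
        have h2 := (abs_le.1 h1).2
        have h3 := sub_nonneg.2 (S.bump_coverBump_mono m p t x)
        nlinarith
    have hdint : Integrable (fun x => (S.bump (coverBump m (p :: t)) x - S.bump (coverBump m t) x)
        * (F (S.pt p.1) + 2 / (m + 1))) (μ : Measure X) :=
      ((hI (p :: t)).sub (hI t)).mul_const _
    have hstep := integral_mono (hint (p :: t)) ((hint t).add hdint) hpt
    simp only [Pi.add_apply] at hstep
    rw [integral_add (hint t) hdint, integral_mul_const, integral_sub (hI (p :: t)) (hI t)] at hstep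
    have hih := ih ht
    simp only [List.map_cons, List.sum_cons, List.length_cons]
    push_cast
    set a := ∫ x, S.bump (coverBump m (p :: t)) x ∂(μ : Measure X)
    set b := ∫ x, S.bump (coverBump m t) x ∂(μ : Measure X)
    have hN' : (0 : ℝ) < N := by exact_mod_cast hN
    have hmk : (0 : ℝ) < ((m : ℝ) + 1) * k := by
      have : (0 : ℝ) < k := by exact_mod_cast hk
      positivity
    have hdiff : a - b ≤ ((p.2 : ℝ) + 1) / N + 1 / ((m + 1) * k) := by
      rw [div_add_div _ _ hN'.ne' hmk.ne', le_div_iff₀ (by positivity)]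
      linarith
    have hmul := mul_le_mul_of_nonneg_right hdiff (hF0 (S.pt p.1))
    have hR : 1 / (((m : ℝ) + 1) * k) * F (S.pt p.1) ≤ R / ((m + 1) * k) := by
      rw [div_mul_eq_mul_div, one_mul]
      gcongr
      exact hFR _
    linarith

theorem integral_diracSum {F : X → ℝ} (hF : Continuous F) (l : List (ℕ × ℕ)) :
    ∫ x, F x ∂(S.diracSum l) = (l.map fun p => ((p.2 : ℝ) + 1) * F (S.pt p.1)).sum := by
  have hint : ∀ (ν : Measure X) [IsFiniteMeasure ν], Integrable F ν := fun ν _ =>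
    hF.integrable_of_hasCompactSupport (HasCompactSupport.of_compactSpace _)
  induction l with
  | nil => simp [diracSum]
  | cons p l ih =>
    have h1 : S.diracSum (p :: l)
        = ((p.2 : ENNReal) + 1) • Measure.dirac (S.pt p.1) + S.diracSum l := by
      simp [diracSum]
    have hc : (p.2 : ENNReal) + 1 ≠ ⊤ := by simp
    have := S.isFiniteMeasure_diracSum l
    rw [h1, integral_add_measure ((hint _).smul_measure hc) (hint _), integral_smul_measure, ih,
      integral_dirac, List.map_cons, List.sum_cons, smul_eq_mul,
      ENNReal.toReal_add (ENNReal.natCast_ne_top _) ENNReal.one_ne_top]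
    simp

theorem integral_idealMeasure {F : X → ℝ} (hF : Continuous F) (c : (ℕ × ℕ) × List (ℕ × ℕ)) :
    ∫ x, F x ∂(S.idealMeasure c : Measure X) = ((c.1 :: c.2).map fun p =>
      ((p.2 : ℝ) + 1) / diracSumWeight (c.1 :: c.2) * F (S.pt p.1)).sum := by
  have h : (S.idealMeasure c : Measure X)
      = ((diracSumWeight (c.1 :: c.2) : ENNReal))⁻¹ • S.diracSum (c.1 :: c.2) := rfl
  rw [h, integral_smul_measure, S.integral_diracSum hF, ENNReal.toReal_inv, ENNReal.toReal_natCast,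
    smul_eq_mul, ← List.sum_map_mul_left]
  congr 1
  refine List.map_congr_left fun p _ => ?_
  rw [← mul_assoc, div_eq_inv_mul]

/-- The one-sided estimate for nonnegative functions is applied to `f` and `-f`, each shifted by a
constant to take values between 0 and twice the diameter. -/
theorem wasserstein_idealMeasure_le {μ : ProbabilityMeasure X} {m : ℕ}
    {c : (ℕ × ℕ) × List (ℕ × ℕ)}
    (hcov : univ ⊆ ⋃ i ∈ (c.1 :: c.2).map fun p => Nat.pair p.1 (Nat.pair 0 m), S.idealBall i)
    (h : S.MassBound μ m (diracSumWeight (c.1 :: c.2)) (c.1 :: c.2).length (c.1 :: c.2)) :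
    wasserstein (S.idealMeasure c) μ ≤ (2 * Metric.diam (univ : Set X) + 2) / (m + 1) := by
  have : Nonempty {f : X → ℝ // LipschitzWith 1 f} := ⟨⟨fun _ => 0, LipschitzWith.const' 0⟩⟩
  have hone := S.bump_coverBump_eq_one hcov
  have key : ∀ F : X → ℝ, LipschitzWith 1 F → (∀ x, 0 ≤ F x) →
      (∀ x, F x ≤ 2 * Metric.diam (univ : Set X)) → ∫ x, F x ∂(μ : Measure X)
        ≤ ∫ x, F x ∂(S.idealMeasure c : Measure X)
          + (2 * Metric.diam (univ : Set X) + 2) / (m + 1) := by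
    intro F hF hF0 hFR
    have h1 := h.integral_mul_le (diracSumWeight_pos c) (by simp) hF hF0 hFR
    rw [← S.integral_idealMeasure hF.continuous c] at h1
    simp only [hone, one_mul, integral_const, probReal_univ, smul_eq_mul, mul_one] at h1
    have hk : (0 : ℝ) < ((c.1 :: c.2).length : ℝ) := by simp; positivity
    have h2 : ((c.1 :: c.2).length : ℝ) * (2 * Metric.diam (univ : Set X)
        / ((m + 1) * (c.1 :: c.2).length)) = 2 * Metric.diam (univ : Set X) / (m + 1) := by
      field_simp
    rw [h2] at h1
    rw [add_div]
    linarith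
  refine ciSup_le fun ⟨f, hf⟩ => ?_
  obtain ⟨x₀⟩ := μ.nonempty
  have hint : ∀ ν : ProbabilityMeasure X, Integrable f (ν : Measure X) := fun ν =>
    hf.continuous.integrable_of_hasCompactSupport (HasCompactSupport.of_compactSpace _)
  have hb : ∀ x, |f x - f x₀| ≤ Metric.diam (univ : Set X) := fun x => by
    have h1 := hf.dist_le_mul x x₀
    rw [Real.dist_eq, NNReal.coe_one, one_mul] at h1
    exact h1.trans (Metric.dist_le_diam_of_mem isCompact_univ.isBounded (mem_univ _) (mem_univ _))
  have k1 := key (fun x => f x + (Metric.diam (univ : Set X) - f x₀))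
    (LipschitzWith.of_dist_le_mul fun x y => by simpa using hf.dist_le_mul x y)
    (fun x => by linarith [(abs_le.1 (hb x)).1]) (fun x => by linarith [(abs_le.1 (hb x)).2])
  have k2 := key (fun x => (Metric.diam (univ : Set X) + f x₀) - f x)
    (LipschitzWith.of_dist_le_mul fun x y => by
      simpa only [dist_sub_left] using hf.dist_le_mul x y)
    (fun x => by linarith [(abs_le.1 (hb x)).2]) (fun x => by linarith [(abs_le.1 (hb x)).1])
  rw [integral_add (hint _) (integrable_const _), integral_add (hint _) (integrable_const _)] at k1
  rw [integral_sub (integrable_const _) (hint _), integral_sub (integrable_const _) (hint _)] at k2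
  simp only [integral_const, probReal_univ, smul_eq_mul, one_mul] at k1 k2
  rw [abs_le]
  constructor <;> linarith

theorem integral_bump_le_one (u : List ℕ × ℕ) (ν : ProbabilityMeasure X) :
    ∫ x, S.bump u x ∂(ν : Measure X) ≤ 1 := by
  simpa using integral_mono (S.integrable_bump u (ν : Measure X)) (integrable_const 1)
    (S.bump_le_one u)

theorem integral_coverBump_mono (μ : ProbabilityMeasure X) (m : ℕ) (p : ℕ × ℕ)
    (l : List (ℕ × ℕ)) : ∫ x, S.bump (coverBump m l) x ∂(μ : Measure X)
      ≤ ∫ x, S.bump (coverBump m (p :: l)) x ∂(μ : Measure X) :=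
  integral_mono (S.integrable_bump _ _) (S.integrable_bump _ _) (S.bump_coverBump_mono m p l)

theorem diracSumWeight_weightedCover (μ : ProbabilityMeasure X) (m n : ℕ) (l : List ℕ) :
    (n : ℝ) * ∫ x, S.bump (coverBump m (S.weightedCover μ m n l)) x ∂(μ : Measure X)
        ≤ diracSumWeight (S.weightedCover μ m n l) ∧
      (diracSumWeight (S.weightedCover μ m n l) : ℝ)
        ≤ n * ∫ x, S.bump (coverBump m (S.weightedCover μ m n l)) x ∂(μ : Measure X)
          + l.length := by
  induction l with
  | nil => simp [weightedCover, diracSumWeight]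
  | cons i t ih =>
    have hmono := S.integral_coverBump_mono μ m (i, 0) (S.weightedCover μ m n t)
    have h0 : (0 : ℝ) ≤ (n : ℝ) * (∫ x, S.bump (coverBump m ((i, 0) :: S.weightedCover μ m n t)) x
      ∂(μ : Measure X) - ∫ x, S.bump (coverBump m (S.weightedCover μ m n t)) x ∂(μ : Measure X)) :=
      mul_nonneg (Nat.cast_nonneg n) (sub_nonneg.2 hmono)
    have h1 := Nat.floor_le h0
    have h2 := Nat.lt_floor_add_one ((n : ℝ) *
      (∫ x, S.bump (coverBump m ((i, 0) :: S.weightedCover μ m n t)) x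
      ∂(μ : Measure X) - ∫ x, S.bump (coverBump m (S.weightedCover μ m n t)) x ∂(μ : Measure X)))
    have hw : ∀ p : ℕ × ℕ, diracSumWeight (p :: S.weightedCover μ m n t)
        = p.2 + 1 + diracSumWeight (S.weightedCover μ m n t) := fun p => by
      simp [diracSumWeight]
    rw [weightedCover, hw, coverBump_cons_congr m i _ 0]
    push_cast [List.length_cons]
    constructor <;> linarith [ih.1, ih.2]

theorem exists_massBound (μ : ProbabilityMeasure X) (m : ℕ) :
    ∃ c : (ℕ × ℕ) × List (ℕ × ℕ),
      (univ ⊆ ⋃ i ∈ (c.1 :: c.2).map fun p => Nat.pair p.1 (Nat.pair 0 m), S.idealBall i) ∧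
      S.MassBound μ m (diracSumWeight (c.1 :: c.2)) (c.1 :: c.2).length (c.1 :: c.2) := by
  obtain ⟨L, hL, hcov⟩ := S.exists_list_cover (isCompact_univ (X := X))
    (p := fun n => ∃ i, n = Nat.pair i (Nat.pair 0 m)) fun x _ => by
      obtain ⟨i, hi⟩ := S.dense.exists_dist_lt x (ε := 1 / ((m : ℝ) + 1)) (by positivity)
      refine ⟨_, ⟨i, rfl⟩, S.mem_idealBall.2 ?_⟩
      rw [dist_comm] at hi
      simpa [ballRadius_eq] using hi
  let I : List ℕ := L.map fun n => n.unpair.1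
  -- With `k = I.length`, the total weight `N` lies between `n` and `n + k`. Rounding thus costs
  -- each slice at most `k` in weight, and after multiplication by `(m + 1) k` this is `n ≤ N`, the
  -- slack in `MassBound`.
  let n : ℕ := I.length * I.length * (m + 1)
  set l := S.weightedCover μ m n I with hl
  have hlen : l.length = I.length := S.length_weightedCover μ m n I
  have hcov' : univ ⊆ ⋃ i ∈ l.map fun p => Nat.pair p.1 (Nat.pair 0 m), S.idealBall i := by
    have h1 : (l.map fun p => Nat.pair p.1 (Nat.pair 0 m)) = L := by
      have h2 : (l.map fun p => Nat.pair p.1 (Nat.pair 0 m))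
          = (l.map Prod.fst).map fun i => Nat.pair i (Nat.pair 0 m) := by
        rw [List.map_map]; rfl
      rw [h2, hl, map_fst_weightedCover, List.map_map]
      conv_rhs => rw [← List.map_id L]
      refine List.map_congr_left fun a ha => ?_
      obtain ⟨i, rfl⟩ := hL a ha
      simp
    rwa [h1]
  have hbound : S.MassBound μ m (diracSumWeight l) l.length l := by
    have h1 : ∫ x, S.bump (coverBump m l) x ∂(μ : Measure X) = 1 := by
      simp [S.bump_coverBump_eq_one hcov']
    obtain ⟨h2, h3⟩ := S.diracSumWeight_weightedCover μ m n I
    rw [← hl, h1, mul_one] at h2 h3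
    intro j hj
    rw [hlen] at hj ⊢
    obtain ⟨i, t, hit⟩ : ∃ i t, I.drop j = i :: t :=
      ⟨_, _, List.drop_eq_getElem_cons hj⟩
    have ht : I.drop (j + 1) = t := by
      rw [← List.tail_drop, hit, List.tail_cons]
    rw [hl, drop_weightedCover, drop_weightedCover, hit, ht, ← hl]
    have h4 := Nat.lt_floor_add_one ((n : ℝ) *
      (∫ x, S.bump (coverBump m ((i, 0) :: S.weightedCover μ m n t)) x
      ∂(μ : Measure X) - ∫ x, S.bump (coverBump m (S.weightedCover μ m n t)) x ∂(μ : Measure X)))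
    have h5 := S.integral_coverBump_mono μ m (i, 0) (S.weightedCover μ m n t)
    have h6 := S.integral_bump_le_one (coverBump m ((i, 0) :: S.weightedCover μ m n t)) μ
    have h7 : 0 ≤ ∫ x, S.bump (coverBump m (S.weightedCover μ m n t)) x ∂(μ : Measure X) :=
      integral_nonneg fun x => S.bump_nonneg _ x
    rw [weightedCover, coverBump_cons_congr m i _ 0, List.headI_cons]
    set w := ⌊(n : ℝ) * (∫ x, S.bump (coverBump m ((i, 0) :: S.weightedCover μ m n t)) x
      ∂(μ : Measure X) - ∫ x, S.bump (coverBump m (S.weightedCover μ m n t)) x ∂(μ : Measure X))⌋₊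
    set a := ∫ x, S.bump (coverBump m ((i, 0) :: S.weightedCover μ m n t)) x ∂(μ : Measure X)
    set b := ∫ x, S.bump (coverBump m (S.weightedCover μ m n t)) x ∂(μ : Measure X)
    have hk : (0 : ℝ) < I.length := by exact_mod_cast (Nat.zero_le j).trans_lt hj
    have hn : (n : ℝ) = I.length * I.length * (m + 1) := by simp [n]
    have h8 : (diracSumWeight l : ℝ) * (a - b) < w + 1 + I.length := by
      have := mul_le_mul_of_nonneg_right h3 (sub_nonneg.2 h5)
      have : (I.length : ℝ) * (a - b) ≤ I.length :=
        mul_le_of_le_one_right hk.le (by linarith)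
      linarith
    have hmk : (0 : ℝ) < ((m : ℝ) + 1) * I.length := by positivity
    have h9 := mul_lt_mul_of_pos_right h8 hmk
    push_cast
    nlinarith
  have hne : l ≠ [] := by
    intro h
    obtain ⟨x⟩ := μ.nonempty
    simpa [h] using hcov' (mem_univ x)
  obtain ⟨p, t, hpt⟩ := List.exists_cons_of_ne_nil hne
  rw [hpt] at hcov' hbound
  exact ⟨(p, t), hcov', hbound⟩

/-- All coefficients in `MassBound` are natural numbers, so each inequality compares integrals of
bump sums with repeated terms. -/
theorem rePred_massBound {μ : ProbabilityMeasure X}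
    (hμ : REPred fun t : List (List ℕ × ℕ) × List (List ℕ × ℕ) =>
      ∫ x, S.bumpSum t.1 x ∂(μ : Measure X) < ∫ x, S.bumpSum t.2 x ∂(μ : Measure X)) :
    REPred fun z : ℕ × List (ℕ × ℕ) =>
      S.MassBound μ z.1 (diracSumWeight z.2) z.2.length z.2 := by
  have : Nonempty X := μ.nonempty
  obtain ⟨one, hone⟩ := S.exists_bump_eq_one
  let τ := ℕ × (ℕ × List (ℕ × ℕ))
  have hl : Computable fun w : τ => w.2.2 := Computable.snd.comp Computable.snd
  have hm : Computable fun w : τ => w.2.1 := Computable.fst.comp Computable.snd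
  have hdrop : Computable fun w : τ => w.2.2.drop w.1 :=
    Primrec.list_drop.to_comp.comp Computable.fst hl
  have hdrop' : Computable fun w : τ => w.2.2.drop (w.1 + 1) :=
    Primrec.list_drop.to_comp.comp (Computable.succ.comp Computable.fst) hl
  have hN : Computable fun w : τ => diracSumWeight w.2.2 := computable_diracSumWeight.comp hl
  have hmul : ∀ {f g : τ → ℕ}, Computable f → Computable g → Computable fun w => f w * g w :=
    fun hf hg => Primrec.nat_mul.to_comp.comp hf hg
  have hmk : Computable fun w : τ => (w.2.1 + 1) * w.2.2.length :=
    hmul (Computable.succ.comp hm) (Computable.list_length.comp hl)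
  have hA : Computable fun w : τ => diracSumWeight w.2.2 * ((w.2.1 + 1) * w.2.2.length) :=
    hmul hN hmk
  have hhead : Computable fun w : τ => (w.2.2.drop w.1).headI.2 + 1 :=
    Computable.succ.comp (Computable.snd.comp (Primrec.list_headI.to_comp.comp hdrop))
  have hB : Computable fun w : τ => ((w.2.2.drop w.1).headI.2 + 1)
      * ((w.2.1 + 1) * w.2.2.length) + diracSumWeight w.2.2 :=
    Primrec.nat_add.to_comp.comp (hmul hhead hmk) hN
  have hb : Computable fun w : τ => coverBump w.2.1 (w.2.2.drop w.1) :=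
    (primrec_coverBump.to_comp.comp (hm.pair hdrop) :)
  have hb' : Computable fun w : τ => coverBump w.2.1 (w.2.2.drop (w.1 + 1)) :=
    (primrec_coverBump.to_comp.comp (hm.pair hdrop') :)
  have h1 : Computable fun w : τ => List.replicate
      (diracSumWeight w.2.2 * ((w.2.1 + 1) * w.2.2.length)) (coverBump w.2.1 (w.2.2.drop w.1)) :=
    Computable.list_replicate.comp hA hb
  have h2 : Computable fun w : τ => List.replicate
      (diracSumWeight w.2.2 * ((w.2.1 + 1) * w.2.2.length))
      (coverBump w.2.1 (w.2.2.drop (w.1 + 1))) ++ List.replicate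
      (((w.2.2.drop w.1).headI.2 + 1) * ((w.2.1 + 1) * w.2.2.length) + diracSumWeight w.2.2) one :=
    Computable.list_append.comp (Computable.list_replicate.comp hA hb')
      (Computable.list_replicate.comp hB (Computable.const one))
  have h3 := (hμ.comp (h1.pair h2)).forall_mem
    (l := fun z : ℕ × List (ℕ × ℕ) => List.range z.2.length)
    ((Primrec.list_range.comp (Primrec.list_length.comp Primrec.snd)).to_comp)
  refine h3.of_eq fun z => forall_congr' fun j => ?_
  simp only [List.mem_range, bumpSum_append, bumpSum_replicate]
  rw [integral_add ((S.integrable_bump _ _).const_mul _) ((S.integrable_bump _ _).const_mul _),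
    integral_const_mul, integral_const_mul, integral_const_mul, S.integral_one hone, mul_one]

theorem isComputableMeasure_of_rePred (hX : S.RecursivelyCompact univ) {μ : ProbabilityMeasure X}
    (hμ : REPred fun t : List (List ℕ × ℕ) × List (List ℕ × ℕ) =>
      ∫ x, S.bumpSum t.1 x ∂(μ : Measure X) < ∫ x, S.bumpSum t.2 x ∂(μ : Measure X)) :
    S.IsComputableMeasure μ := by
  obtain ⟨R, hR⟩ := exists_nat_ge (2 * Metric.diam (univ : Set X) + 2)
  let τ := ℕ × ((ℕ × ℕ) × List (ℕ × ℕ))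
  have hl : Computable fun w : τ => w.2.1 :: w.2.2 :=
    Computable.list_cons.comp (Computable.fst.comp Computable.snd)
      (Computable.snd.comp Computable.snd)
  have hm : Computable fun w : τ => R * 2 ^ w.1 :=
    Primrec.nat_mul.to_comp.comp (Computable.const R)
      (Computable.nat_pow.comp (Computable.const 2) Computable.fst)
  have hballs : Primrec fun x : ℕ × List (ℕ × ℕ) =>
      x.2.map fun p => Nat.pair p.1 (Nat.pair 0 x.1) := by
    have h1 : Primrec₂ fun (x : ℕ × List (ℕ × ℕ)) (p : ℕ × ℕ) =>
        Nat.pair p.1 (Nat.pair 0 x.1) :=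
      Primrec₂.natPair.comp (Primrec.fst.comp Primrec.snd)
        (Primrec₂.natPair.comp (Primrec.const 0) (Primrec.fst.comp Primrec.fst))
    exact Primrec.list_map Primrec.snd h1
  -- With `m = R * 2 ^ n` the error is at most `R / (R * 2 ^ n + 1) < 2⁻ⁿ`. Covering and mass bound
  -- are both semi-decidable, so a search finds a suitable ideal measure.
  obtain ⟨φ, hφ, h⟩ := (((hX.2.comp hballs.to_comp).and (S.rePred_massBound hμ)).comp
    (hm.pair hl)).exists_computable fun n => S.exists_massBound μ (R * 2 ^ n)
  refine ⟨φ, hφ, fun n => (S.wasserstein_idealMeasure_le (h n).1 (h n).2).trans_lt ?_⟩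
  have h2 : (0 : ℝ) < 2 ^ n := by positivity
  rw [one_div, inv_pow, ← one_div, div_lt_div_iff₀ (by positivity) h2]
  push_cast
  nlinarith

end ComputableMetricStructure

theorem proposition4p4 {X : Type*} [MetricSpace X] [MeasurableSpace X] [BorelSpace X]
    (S : ComputableMetricStructure X) (hX : S.RecursivelyCompact Set.univ)
    (T : X → X) (hT : Measurable T)
    (D : Set X) (hTD : S.ComputableOn T Dᶜ) (hD : dimH D < ⊤)
    (α K : ℝ) (hαD : (dimH D : EReal) < (α : EReal)) :
    (∀ ν ∈ regMeasures X α K, (ν : MeasureTheory.Measure X) D = 0) ∧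
      (IsComputableReal α → IsComputableReal K →
        ∀ μ : MeasureTheory.ProbabilityMeasure X,
          IsIsolatedInvariant T (regMeasures X α K) μ → S.IsComputableMeasure μ) := by
  refine ⟨fun ν hν => measure_eq_zero_of_dimH_lt hαD hν, fun hα hK μ hμ => ?_⟩
  have : CompactSpace X := ⟨hX.1⟩
  exact S.isComputableMeasure_of_rePred hX
    (S.rePred_integral_lt_of_isIsolatedInvariant hX hT hTD hαD hα hK hμ)
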